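/- Let $N>2$ and let $f:[0,\infty)\to\mathbb R$ be continuous, and $C^1$ on $(0,\infty)$ except possibly at finitely many points. Suppose $f(0)=0$ and there is $b\ge 0$ with $f>0$ on $(b,\infty)$, $f\le 0$ on $[0,b]$, $f<0$ on $(0,\epsilon)$ for some $\epsilon>0$, and $f\neq 0$ on $(0,b)$. Extend $f$ to $\mathbb R$ as an odd function, put $F(s)=\int_0^s f$, and suppose that there is a unique $\beta\ge b$ with $F(\beta)=0$. For $\alpha\ge\beta$ let $u=u(\cdot,\alpha)$ be a solution of $$u''+\frac{N-1}{r}u'+f(u)=0\quad (r>0),\qquad u(0)=\alpha,\quad u'(0)=0,$$ continued by $0$ if it reaches a double zero ($u=u'=0$). Let $\mathcal J(r)=-u'(r)/r$ for $r>0$, let $\mathcal J(0)=\lim_{r\to0^+}\mathcal J(r)$, and let $\gamma(r)=(u(r),\mathcal J(r))$ for $r\ge0$, a curve in the plane with coordinates $(s,J)$. Set $T_0=Z_0=0$ and, for $k\ge1$, $$Z_k=\sup\{r>T_{k-1}: (-1)^ku<0 \text{ and } (-1)^ku'>0 \text{ on }(T_{k-1},r)\},\qquad T_k=\sup\{r>Z_k: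 (-1)^{k+1}u'\le 0\text{ on }(Z_k,r)\},$$ where $Z_k=\infty$ if $T_{k-1}=\infty$, $T_k=\infty$ if $Z_k=\infty$, and values at $\infty$ are limits. Let $\mathcal N_0=[\beta,\infty)$ and, for $k\ge1$, $$\mathcal N_k=\{\alpha\in\mathcal N_{k-1}: u(Z_k)=0,\ (-1)^ku'(Z_k)>0\},\quad \mathcal G_k=\{\alpha\in\mathcal N_{k-1}: u(Z_k)=u'(Z_k)=0\},\quad \mathcal P_k=\{\alpha\in\mathcal N_{k-1}: (-1)^ku(Z_k)<0\}.$$ A piece of $\gamma$ is said to spiral inwards counterclockwise about a point $(c,0)$ if it avoids $(c,0)$, has a continuous polar angle about $(c,0)$, crosses each of the four half-axes issuing from $(c,0)$ (horizontal and vertical) only in the direction of increasing angle, and successive points of the piece on the same half-axis are strictly closer to $(c,0)$. Then: (i) $\gamma$ is continuous, $\gamma(0)=(\alpha,f(\alpha)/N)$, and $\gamma$ has no self-intersections as long as $\gamma(r)\ne(0,0)$. It moves inwards: if $0\le r_1<r_2$, $\gamma(r_1)\neq(0,0)$ and $u(r_1)=u(r_2)$, then $|\mathcal J(r_2)|<|\mathcal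 J(r_1)|$. (ii) There is a finite $k\ge0$ such that $\gamma$ crosses the line $s=0$ (i.e. $u(r)=0$, $\mathcal J(r)\ne0$, $r>0$) exactly $k$ times, and $\alpha\in\mathcal N_k\setminus\mathcal N_{k+1}$. The radius $R=Z_k$ is finite and, if $k\ge1$, it is the last of these crossings. On $[0,R]$ the curve spirals inwards counterclockwise about the origin, and it meets the $s$-axis only outside $(-\beta,\beta)$. (iii) For $r\ge R$, as long as $\gamma(r)\neq(0,0)$, the curve spirals inwards counterclockwise about $((-1)^kb,0)$. Let $j\in\{0,1,\dots,\infty\}$ be the number of $r>R$ with $\mathcal J(r)=0$ and $u(r)\neq0$, increased by one if $k=0$ (the initial point is then counted). (a) If $j=0$, then $\gamma(r)\to((-1)^kb,0)$ as $r\to\infty$, so that $u\to(-1)^kb$, and $\alpha\in\mathcal P_{k+1}$. (b) If $j=1$, then either $\gamma(r)\to((-1)^kb,0)$ and $\alpha\in\mathcal P_{k+1}$, or $\gamma(r)\to(0,0)$, $\alpha\in\mathcal G_{k+1}$ and $u$ is a bound state, i.e. a nonconstant solution tending to $0$ at infinity, that changes sign exactly $k$ times. (c) If $j\ge2$ (including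 $j=\infty$), then $\gamma(r)\to((-1)^kb,0)$ and $\alpha\in\mathcal P_{k+1}$. If $j=\infty$, the curve winds around $((-1)^kb,0)$ forever: its polar angle about that point tends to $+\infty$. -/

import Mathlib

open Set Filter Topology

namespace RadialJ

noncomputable section

/-- The primitive `F(s) = ∫₀ˢ f`. -/
def primF (f : ℝ → ℝ) (s : ℝ) : ℝ := ∫ t in (0 : ℝ)..s, f t

/-- The standing hypothesis on the nonlinearity, for the odd extension of `f` to `ℝ`. -/
structure HypH1 (f : ℝ → ℝ) (b β : ℝ) : Prop where
  cont : ContinuousOn f (Ici 0)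
  c1 : ∃ S : Set ℝ, S.Finite ∧ ContDiffOn ℝ 1 f (Ioi 0 \ S)
  zero : f 0 = 0
  odd : ∀ s, f (-s) = -f s
  b_nonneg : 0 ≤ b
  pos : ∀ s, b < s → 0 < f s
  nonpos : ∀ s ∈ Icc 0 b, f s ≤ 0
  neg_near_zero : ∃ ε > 0, ∀ s ∈ Ioo 0 ε, f s < 0
  b_le_beta : b ≤ β
  primF_beta : primF f β = 0
  beta_unique : ∀ s, b ≤ s → primF f s = 0 → s = β

/-- `w`, restricted to `[0, ∞)`, solves `w'' + (N-1)/r w' + f(w) = 0` for `r > 0` with `w(0) = α`,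
`w'(0) = 0`, and is continued by `0` once it reaches a double zero. -/
structure IsRadialSolution (N : ℝ) (f : ℝ → ℝ) (α : ℝ) (w : ℝ → ℝ) : Prop where
  init : w 0 = α
  init_deriv : HasDerivWithinAt w 0 (Ici 0) 0
  diff : ∀ r, 0 < r → DifferentiableAt ℝ w r
  ode : ∀ r, 0 < r → HasDerivAt (deriv w) (-((N - 1) / r * deriv w r + f (w r))) r
  zero_ext : ∀ r₀, 0 < r₀ → w r₀ = 0 → deriv w r₀ = 0 → ∀ r, r₀ ≤ r → w r = 0

/-- `𝒥(r) = -w'(r)/r`, with its limit as value at `r = 0`. -/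
def opJ (w : ℝ → ℝ) (r : ℝ) : ℝ :=
  if r = 0 then limUnder (𝓝[>] (0 : ℝ)) (fun t => -deriv w t / t) else -deriv w r / r

/-- The curve `r ↦ (w(r), 𝒥(r))`. -/
def curveJ (w : ℝ → ℝ) (r : ℝ) : ℝ × ℝ := (w r, opJ w r)

/-- Value of `g` at a radius in `[0, ∞]`; at `∞` it is the limit. -/
def atRadius (g : ℝ → ℝ) (z : EReal) : ℝ :=
  if z = ⊤ then limUnder atTop g else g z.toReal

/-- `sup {r > t | (-1)^k w < 0 and (-1)^k w' > 0 on (t, r)}`, and `∞` if `t = ∞`. -/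
def crossFrom (w : ℝ → ℝ) (k : ℕ) (t : EReal) : EReal :=
  if t = ⊤ then ⊤ else
    sSup {x : EReal | ∃ r : ℝ, x = r ∧ t < r ∧
      ∀ s : ℝ, t < s → s < r → (-1) ^ k * w s < 0 ∧ 0 < (-1) ^ k * deriv w s}

/-- `sup {r > z | (-1)^k w' ≤ 0 on (z, r)}`, and `∞` if `z = ∞`. -/
def turnFrom (w : ℝ → ℝ) (k : ℕ) (z : EReal) : EReal :=
  if z = ⊤ then ⊤ else
    sSup {x : EReal | ∃ r : ℝ, x = r ∧ z < r ∧
      ∀ s : ℝ, z < s → s < r → (-1) ^ k * deriv w s ≤ 0}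

/-- `T₀ = 0`, and `T_k` is the first turning radius after `Z_k`. -/
def turnT (w : ℝ → ℝ) : ℕ → EReal
  | 0 => 0
  | k + 1 => turnFrom w (k + 2) (crossFrom w (k + 1) (turnT w k))

/-- `Z₀ = 0`, and `Z_{k+1}` is where `w` stops returning monotonically to `0` after `T_k`. -/
def zeroZ (w : ℝ → ℝ) : ℕ → EReal
  | 0 => 0
  | k + 1 => crossFrom w (k + 1) (turnT w k)

/-- The sets `𝒩_k` of the family `u α = u(·, α)`, with `𝒩_0 = [β, ∞)`. -/
def setN (β : ℝ) (u : ℝ → ℝ → ℝ) : ℕ → Set ℝ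
  | 0 => Ici β
  | k + 1 => {α | α ∈ setN β u k ∧ atRadius (u α) (zeroZ (u α) (k + 1)) = 0 ∧
      0 < (-1) ^ (k + 1) * atRadius (deriv (u α)) (zeroZ (u α) (k + 1))}

/-- The sets `𝒢_k`, `k ≥ 1`. -/
def setG (β : ℝ) (u : ℝ → ℝ → ℝ) : ℕ → Set ℝ
  | 0 => ∅
  | k + 1 => {α | α ∈ setN β u k ∧ atRadius (u α) (zeroZ (u α) (k + 1)) = 0 ∧
      atRadius (deriv (u α)) (zeroZ (u α) (k + 1)) = 0}

/-- The sets `𝒫_k`, `k ≥ 1`. -/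
def setP (β : ℝ) (u : ℝ → ℝ → ℝ) : ℕ → Set ℝ
  | 0 => ∅
  | k + 1 => {α | α ∈ setN β u k ∧
      (-1) ^ (k + 1) * atRadius (u α) (zeroZ (u α) (k + 1)) < 0}

/-- Radii where the curve crosses the line `s = 0`. The condition `𝒥 ≠ 0` excludes the part
where `w` has been continued by `0`. -/
def lineCrossings (w : ℝ → ℝ) : Set ℝ := {r | 0 < r ∧ w r = 0 ∧ opJ w r ≠ 0}

/-- The number `j` of intersections with the `s`-axis after radius `R`, the radius of the `k`-th
crossing of `s = 0`; for `k = 0` the initial point counts as one. -/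
def axisCount (w : ℝ → ℝ) (k : ℕ) (R : ℝ) : ℕ∞ :=
  (if k = 0 then 1 else 0) + {r | R < r ∧ w r ≠ 0 ∧ opJ w r = 0}.encard

/-- `(ρ, θ)` are polar coordinates of `γ` about `(c, 0)` on `A`, with continuous angle `θ`. -/
def IsPolar (γ : ℝ → ℝ × ℝ) (c : ℝ) (A : Set ℝ) (ρ θ : ℝ → ℝ) : Prop :=
  ContinuousOn θ A ∧ ∀ r ∈ A, 0 < ρ r ∧
    γ r = (c + ρ r * Real.cos (θ r), ρ r * Real.sin (θ r))

/-- On `A` the curve `γ` turns counterclockwise and inwards about `(c, 0)`: it crosses each of the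
four half-axes issuing from `(c, 0)` only in the direction of increasing angle, and successive
points on the same half-axis are strictly closer to `(c, 0)`. -/
def SpiralsInAbout (γ : ℝ → ℝ × ℝ) (c : ℝ) (A : Set ℝ) : Prop :=
  ∃ ρ θ : ℝ → ℝ, IsPolar γ c A ρ θ ∧
    (∀ r₁ ∈ A, ∀ r₂ ∈ A, r₁ < r₂ → ∀ m : ℤ,
      m * (Real.pi / 2) ≤ θ r₁ → m * (Real.pi / 2) < θ r₂) ∧
    (∀ r₁ ∈ A, ∀ r₂ ∈ A, r₁ < r₂ → ∀ m n : ℤ,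
      θ r₁ = m * (Real.pi / 2) → θ r₂ = θ r₁ + n * (2 * Real.pi) → ρ r₂ < ρ r₁)

/-- The polar angle of `γ` about `(c, 0)` tends to `+∞`. -/
def WindsForeverAbout (γ : ℝ → ℝ × ℝ) (c R : ℝ) : Prop :=
  ∃ ρ θ : ℝ → ℝ, IsPolar γ c (Ici R) ρ θ ∧ Tendsto θ atTop atTop

/-- Radii at which `w` changes sign. -/
def signChanges (w : ℝ → ℝ) : Set ℝ :=
  {r | 0 < r ∧ ∃ ε > 0, ∀ s ∈ Ioo (r - ε) r, ∀ t ∈ Ioo r (r + ε), w s * w t < 0}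

/-- A (nonconstant, radial) bound state solution with exactly `k` sign changes. -/
def IsBoundState (N : ℝ) (f : ℝ → ℝ) (w : ℝ → ℝ) (k : ℕ) : Prop :=
  IsRadialSolution N f (w 0) w ∧ (∃ r > 0, w r ≠ w 0) ∧ Tendsto w atTop (𝓝 0) ∧
    (signChanges w).encard = k

end

end RadialJ

open RadialJ

/-! Write `y = r𝒥 = -w'`. The energy `E = y²/2 + F(w)` has derivative `-(N-1)y²/r`, so friction
makes it decrease, strictly until the curve reaches the origin (`energy_strict`). Two visits to a
vertical line share the same `F(w)`, so `|y|` and a fortiori `|𝒥|` shrinks: this is the inward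
motion and excludes self-intersections. At points with `𝒥 = 0` the energy is `F(w)`, and the
double-well shape of `F`, with minima exactly at `±b`, turns its decrease into a decrease of the
distance to the centre. The sense of rotation is read off on the half-axes: `w' = -r𝒥` on vertical
ones, `𝒥' = f(w)/r` on horizontal ones (`angle_lt`). A Grönwall bound (`F_b_lt_energy`) keeps the
curve off `(±b, 0)`.

The global picture is an induction over the crossings of `s = 0` (`Stage.outcome`): after a crossing
the orbit rises to a turn (or forever), then falls, and it is either captured away from `w = 0`, or
tends to the origin, or crosses again. A captured orbit converges to `±b`: a perturbed energy loses
at least a constant times `1/r`, whose integral diverges, while it is bounded below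
(`exists_energy_lt`).

Crossings are finitely many (`not_forall_turning`). Otherwise the energies `e_i` at the turning
radii `T_i` stay positive; for large radii each swing costs at least `c/T_i` and lasts at most
`C/√e_{i+1}`, so `√e` drops by a constant times the relative gap `(T_{i+1}-T_i)/T_{i+1}`. These gaps
sum to infinity since `T_i → ∞`, a contradiction (`not_forall_slow_descent`). -/

/-! ### Mean value inequalities and first zeros -/

theorem sub_le_of_hasDerivAt_le {g g' : ℝ → ℝ} {a c C : ℝ} (hac : a ≤ c)
    (hc : ContinuousOn g (Icc a c)) (hd : ∀ x ∈ Ioo a c, HasDerivAt g (g' x) x)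
    (h : ∀ x ∈ Ioo a c, g' x ≤ C) : g c - g a ≤ C * (c - a) := by
  refine (convex_Icc a c).image_sub_le_mul_sub_of_deriv_le hc ?_ ?_ a ⟨le_rfl, hac⟩ c
    ⟨hac, le_rfl⟩ hac
  · rw [interior_Icc]
    exact fun x hx => (hd x hx).differentiableAt.differentiableWithinAt
  · rw [interior_Icc]
    intro x hx
    rw [(hd x hx).deriv]
    exact h x hx

theorem le_sub_of_le_hasDerivAt {g g' : ℝ → ℝ} {a c C : ℝ} (hac : a ≤ c)
    (hc : ContinuousOn g (Icc a c)) (hd : ∀ x ∈ Ioo a c, HasDerivAt g (g' x) x)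
    (h : ∀ x ∈ Ioo a c, C ≤ g' x) : C * (c - a) ≤ g c - g a := by
  have := sub_le_of_hasDerivAt_le (g := fun x => -g x) (g' := fun x => -g' x) (C := -C) hac hc.neg
    (fun x hx => (hd x hx).neg) (fun x hx => neg_le_neg (h x hx))
  linarith

/-- Either a continuous function stays positive, or it has a first zero. -/
theorem forall_pos_or_exists_first_zero {g : ℝ → ℝ} {a : ℝ} (hc : ContinuousOn g (Ici a))
    (ha : 0 < g a) :
    (∀ r, a ≤ r → 0 < g r) ∨ ∃ z, a < z ∧ g z = 0 ∧ ∀ r, a ≤ r → r < z → 0 < g r := by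
  by_cases h : ∀ r, a ≤ r → 0 < g r
  · exact Or.inl h
  right
  push Not at h
  obtain ⟨r₁, hr₁, hg₁⟩ := h
  obtain ⟨z₀, hz₀, hgz₀⟩ : (0 : ℝ) ∈ g '' Icc a r₁ :=
    intermediate_value_Icc' hr₁ (hc.mono Icc_subset_Ici_self) ⟨hg₁, ha.le⟩
  set S : Set ℝ := Ici a ∩ g ⁻¹' {0} with hS
  have hScl : IsClosed S := hc.preimage_isClosed_of_isClosed isClosed_Ici isClosed_singleton
  have hSne : S.Nonempty := ⟨z₀, hz₀.1, hgz₀⟩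
  have hSb : BddBelow S := ⟨a, fun x hx => hx.1⟩
  have hmem := hScl.csInf_mem hSne hSb
  have hz0 : g (sInf S) = 0 := hmem.2
  have hza : a < sInf S := by
    refine lt_of_le_of_ne hmem.1 fun h => ?_
    rw [← h] at hz0
    exact ha.ne' hz0
  refine ⟨sInf S, hza, hz0, fun r hr hrz => ?_⟩
  by_contra hneg
  push Not at hneg
  obtain ⟨z, hz, hgz⟩ : (0 : ℝ) ∈ g '' Icc a r :=
    intermediate_value_Icc' hr (hc.mono Icc_subset_Ici_self) ⟨hneg, ha.le⟩
  have := csInf_le hSb (show z ∈ S from ⟨hz.1, hgz⟩)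
  linarith [hz.2]

theorem HasDerivAt.eventually_sign_of_pos {g : ℝ → ℝ} {d x : ℝ} (h : HasDerivAt g d x)
    (hd : 0 < d) (hx : g x = 0) :
    ∃ ε > 0, (∀ s ∈ Ioo (x - ε) x, g s < 0) ∧ ∀ s ∈ Ioo x (x + ε), 0 < g s := by
  have h1 := h.tendsto_slope.eventually (lt_mem_nhds hd)
  rw [eventually_nhdsWithin_iff, Metric.eventually_nhds_iff] at h1
  obtain ⟨ε, hε, h1⟩ := h1
  refine ⟨ε, hε, fun s hs => ?_, fun s hs => ?_⟩
  · have := h1 (y := s) (by rw [Real.dist_eq, abs_lt]; constructor <;> linarith [hs.1, hs.2])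
      (by simpa using hs.2.ne)
    rw [slope_def_field, hx, sub_zero] at this
    by_contra hneg
    exact absurd this (not_lt.2 (div_nonpos_of_nonneg_of_nonpos (not_lt.1 hneg)
      (by linarith [hs.2])))
  · have := h1 (y := s) (by rw [Real.dist_eq, abs_lt]; constructor <;> linarith [hs.1, hs.2])
      (by simpa using hs.1.ne')
    rw [slope_def_field, hx, sub_zero] at this
    by_contra hneg
    exact absurd this (not_lt.2 (div_nonpos_of_nonpos_of_nonneg (not_lt.1 hneg)
      (by linarith [hs.1])))

/-! ### The nonlinearity and its double-well potential -/

/-- The sign pattern of the nonlinearity on the whole line. -/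
structure Shape (f : ℝ → ℝ) (b β : ℝ) : Prop where
  cont : Continuous f
  odd : ∀ s, f (-s) = -f s
  b_pos : 0 < b
  b_lt : b < β
  neg : ∀ s, 0 < s → s < b → f s < 0
  pos : ∀ s, b < s → 0 < f s
  f_b : f b = 0
  F_beta : primF f β = 0

/-- If `b = 0`, `f` would have both signs just right of `0`. Continuity gives `f b = 0` from the two
one-sided signs, and `b < β` because `F(b) < 0 = F(β)`. -/
theorem RadialJ.HypH1.shape {f : ℝ → ℝ} {b β : ℝ} (hf : HypH1 f b β)
    (hb : ∀ s ∈ Ioo 0 b, f s ≠ 0) : Shape f b β := by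
  have hcont : Continuous f := by
    have h1 : ContinuousOn f (Iic 0) := by
      have : ContinuousOn (fun s => -f (-s)) (Iic 0) :=
        (hf.cont.comp continuousOn_neg (fun s (hs : s ≤ 0) => by simpa using hs)).neg
      refine this.congr fun s _ => ?_
      simp [hf.odd]
    have := h1.union_of_isClosed hf.cont isClosed_Iic isClosed_Ici
    rwa [Iic_union_Ici, continuousOn_univ] at this
  have hbpos : 0 < b := by
    obtain ⟨ε, hε, h⟩ := hf.neg_near_zero
    by_contra hb0
    have h1 := h (ε / 2) ⟨by linarith, by linarith⟩
    have h2 := hf.pos (ε / 2) (by linarith)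
    linarith
  have hneg : ∀ s, 0 < s → s < b → f s < 0 := fun s h0 h1 =>
    lt_of_le_of_ne (hf.nonpos s ⟨h0.le, h1.le⟩) (hb s ⟨h0, h1⟩)
  have hfb : f b = 0 := by
    refine le_antisymm (hf.nonpos b ⟨hbpos.le, le_rfl⟩) ?_
    have : Tendsto f (𝓝[>] b) (𝓝 (f b)) := hcont.continuousAt.mono_left nhdsWithin_le_nhds
    refine ge_of_tendsto this ?_
    filter_upwards [self_mem_nhdsWithin] with s hs using (hf.pos s hs).le
  refine ⟨hcont, hf.odd, hbpos, ?_, hneg, hf.pos, hfb, hf.primF_beta⟩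
  refine lt_of_le_of_ne hf.b_le_beta ?_
  rintro rfl
  have h0 := hf.primF_beta
  unfold primF at h0
  have : (∫ t in (0:ℝ)..b, (-f t)) > 0 := by
    refine intervalIntegral.intervalIntegral_pos_of_pos_on
      (hcont.neg.intervalIntegrable _ _) (fun x hx => ?_) hbpos
    have := hneg x hx.1 hx.2
    linarith
  rw [intervalIntegral.integral_neg] at this
  linarith

namespace Shape

variable {f : ℝ → ℝ} {b β : ℝ}

theorem f_zero (S : Shape f b β) : f 0 = 0 := by
  have := S.odd 0
  simp at this
  linarith

theorem F_zero : primF f 0 = 0 := by simp [primF]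

theorem hasDerivAt_F (S : Shape f b β) (s : ℝ) : HasDerivAt (primF f) (f s) s :=
  intervalIntegral.integral_hasDerivAt_right (S.cont.intervalIntegrable _ _)
    (S.cont.stronglyMeasurableAtFilter _ _) S.cont.continuousAt

theorem continuous_F (S : Shape f b β) : Continuous (primF f) :=
  continuous_iff_continuousAt.2 fun s => (S.hasDerivAt_F s).continuousAt

theorem F_neg (S : Shape f b β) (s : ℝ) : primF f (-s) = primF f s := by
  unfold primF
  have h := intervalIntegral.integral_comp_neg (a := 0) (b := s) f
  simp only [neg_zero] at h
  rw [intervalIntegral.integral_symm, ← h]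
  simp [S.odd]

theorem F_abs (S : Shape f b β) (s : ℝ) : primF f |s| = primF f s := by
  rcases abs_choice s with h | h <;> rw [h]
  exact S.F_neg s

theorem F_strictAntiOn (S : Shape f b β) : StrictAntiOn (primF f) (Icc 0 b) := by
  refine strictAntiOn_of_deriv_neg (convex_Icc 0 b) S.continuous_F.continuousOn fun x hx => ?_
  rw [interior_Icc] at hx
  rw [(S.hasDerivAt_F x).deriv]
  exact S.neg x hx.1 hx.2

theorem F_strictMonoOn (S : Shape f b β) : StrictMonoOn (primF f) (Ici b) := by
  refine strictMonoOn_of_deriv_pos (convex_Ici b) S.continuous_F.continuousOn fun x hx => ?_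
  rw [interior_Ici] at hx
  rw [(S.hasDerivAt_F x).deriv]
  exact S.pos x hx

theorem F_b_lt (S : Shape f b β) {s : ℝ} (hs : |s| ≠ b) : primF f b < primF f s := by
  rw [← S.F_abs s]
  rcases lt_or_gt_of_ne hs with h | h
  · exact S.F_strictAntiOn ⟨abs_nonneg s, h.le⟩ ⟨S.b_pos.le, le_rfl⟩ h
  · exact S.F_strictMonoOn (mem_Ici.2 le_rfl) (mem_Ici.2 h.le) h

theorem F_b_le (S : Shape f b β) (s : ℝ) : primF f b ≤ primF f s := by
  by_cases h : |s| = b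
  · rw [← S.F_abs s, h]
  · exact (S.F_b_lt h).le

/-- `F` falls from `0` on `[0, b]` and climbs back to `0` only at `β`. This potential well is what
separates captured orbits from crossing ones. -/
theorem F_lt_zero (S : Shape f b β) {s : ℝ} (h0 : s ≠ 0) (h1 : |s| < β) : primF f s < 0 := by
  rw [← S.F_abs s]
  have hp := abs_pos.2 h0
  rcases le_or_gt |s| b with h | h
  · have := S.F_strictAntiOn ⟨le_rfl, S.b_pos.le⟩ ⟨hp.le, h⟩ hp
    rwa [F_zero] at this
  · have := S.F_strictMonoOn (mem_Ici.2 h.le) (mem_Ici.2 S.b_lt.le) h1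
    rwa [S.F_beta] at this

theorem F_le_zero (S : Shape f b β) {s : ℝ} (h1 : |s| ≤ β) : primF f s ≤ 0 := by
  rcases eq_or_ne s 0 with rfl | h0
  · exact F_zero.le
  rcases h1.lt_or_eq with h | h
  · exact (S.F_lt_zero h0 h).le
  · rw [← S.F_abs s, h, S.F_beta]

theorem F_le_imp_abs_le (S : Shape f b β) {s t : ℝ} (ht : b ≤ |t|) (h : primF f s ≤ primF f t) :
    |s| ≤ |t| := by
  by_contra hlt
  push Not at hlt
  have := S.F_strictMonoOn (mem_Ici.2 ht) (mem_Ici.2 (ht.trans hlt.le)) hlt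
  rw [S.F_abs, S.F_abs] at this
  linarith

theorem f_eq_zero_iff (S : Shape f b β) (s : ℝ) : f s = 0 ↔ s = 0 ∨ |s| = b := by
  have key : ∀ t, 0 ≤ t → f t = 0 → t = 0 ∨ |t| = b := by
    intro t ht h
    rcases ht.eq_or_lt with h0 | h0
    · exact Or.inl h0.symm
    rw [abs_of_pos h0]
    rcases lt_trichotomy t b with h1 | h1 | h1
    · exact absurd h (S.neg t h0 h1).ne
    · exact Or.inr h1
    · exact absurd h (S.pos t h1).ne'
  constructor
  · intro h
    rcases le_total 0 s with h0 | h0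
    · exact key s h0 h
    · have := key (-s) (by linarith) (by rw [S.odd, h, neg_zero])
      simpa using this
  · rintro (rfl | h)
    · exact S.f_zero
    · rcases abs_choice s with h1 | h1
      · rw [← h1, h, S.f_b]
      · have : s = -b := by linarith
        rw [this, S.odd, S.f_b, neg_zero]

theorem sub_mul_f_pos (S : Shape f b β) {s : ℝ} (h0 : 0 < s) (h1 : s ≠ b) :
    0 < (s - b) * f s := by
  rcases lt_or_gt_of_ne h1 with h | h
  · exact mul_pos_of_neg_of_neg (by linarith) (S.neg s h0 h)
  · exact mul_pos (by linarith) (S.pos s h)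

theorem mul_f_pos (S : Shape f b β) {s : ℝ} (h : b < |s|) : 0 < s * f s := by
  rcases le_total 0 s with h0 | h0
  · rw [abs_of_nonneg h0] at h
    exact mul_pos (S.b_pos.trans h) (S.pos s h)
  · rw [abs_of_nonpos h0] at h
    have := mul_pos (S.b_pos.trans h) (S.pos (-s) h)
    rw [S.odd] at this
    linarith

end Shape

/-! ### Orbits: behaviour at the origin, energy, inward motion, reflection -/

/-- A radial solution issuing from a height at least `β`. -/
structure Orbit (N : ℝ) (f : ℝ → ℝ) (b β α : ℝ) (w : ℝ → ℝ) : Prop where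
  two_lt : 2 < N
  shape : Shape f b β
  sol : IsRadialSolution N f α w
  le_abs : β ≤ |α|

/-- The energy `w'² / 2 + F(w)`. -/
noncomputable def energy (f w : ℝ → ℝ) (r : ℝ) : ℝ := (r * opJ w r) ^ 2 / 2 + primF f (w r)

theorem opJ_of_pos (w : ℝ → ℝ) {r : ℝ} (hr : 0 < r) : opJ w r = -deriv w r / r := by
  simp [opJ, hr.ne']

theorem deriv_eq_opJ (w : ℝ → ℝ) {r : ℝ} (hr : 0 < r) : deriv w r = -(r * opJ w r) := by
  rw [opJ_of_pos w hr]
  field_simp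

namespace Orbit

variable {N : ℝ} {f : ℝ → ℝ} {b β α : ℝ} {w : ℝ → ℝ}

theorem b_lt_abs (O : Orbit N f b β α w) : b < |α| := O.shape.b_lt.trans_le O.le_abs

theorem f_init_ne (O : Orbit N f b β α w) : f α ≠ 0 := by
  rw [Ne, O.shape.f_eq_zero_iff]
  have h := O.b_lt_abs
  rintro (h0 | h0)
  · rw [h0, abs_zero] at h
    exact absurd O.shape.b_pos h.le.not_gt
  · exact h.ne' h0

theorem hasDerivAt (O : Orbit N f b β α w) {r : ℝ} (hr : 0 < r) :
    HasDerivAt w (-(r * opJ w r)) r := by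
  rw [← deriv_eq_opJ w hr]
  exact (O.sol.diff r hr).hasDerivAt

theorem continuousOn (O : Orbit N f b β α w) : ContinuousOn w (Ici 0) := by
  intro r hr
  rcases (mem_Ici.1 hr).eq_or_lt with rfl | h
  · exact O.sol.init_deriv.continuousWithinAt
  · exact (O.sol.diff r h).continuousAt.continuousWithinAt

/-- Divergence form of the equation: the weight absorbs the singular first-order term. -/
theorem hasDerivAt_weighted (O : Orbit N f b β α w) {r : ℝ} (hr : 0 < r) :
    HasDerivAt (fun r => r ^ (N - 1) * deriv w r) (-(r ^ (N - 1) * f (w r))) r := by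
  have h1 := (Real.hasDerivAt_rpow_const (x := r) (p := N - 1) (Or.inl hr.ne')).mul
    (O.sol.ode r hr)
  refine h1.congr_deriv ?_
  have : r ^ (N - 1) = r ^ (N - 1 - 1) * r := by
    rw [← Real.rpow_add_one hr.ne']
    ring_nf
  rw [this]
  field_simp
  ring

/-- The singular solutions of the linear part are excluded by boundedness at the origin. -/
theorem exists_weighted_bound (O : Orbit N f b β α w) :
    ∃ C : ℝ, ∀ r ∈ Ioo (0 : ℝ) 1, |r ^ (N - 1) * deriv w r| ≤ C * r := by
  have hN := O.two_lt
  obtain ⟨M, hM⟩ := (isCompact_Icc (a := (0 : ℝ)) (b := 1)).exists_bound_of_continuousOn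
    ((O.shape.cont.comp_continuousOn O.continuousOn).mono Icc_subset_Ici_self)
  have hM0 : 0 ≤ M := (norm_nonneg _).trans (hM 0 (by simp))
  have hlip : ∀ s r : ℝ, 0 < s → s ≤ r → r < 1 →
      |r ^ (N - 1) * deriv w r - s ^ (N - 1) * deriv w s| ≤ M * (r - s) := by
    intro s r hs hsr hr
    have hd : ∀ x ∈ Icc s r, HasDerivAt (fun r => r ^ (N - 1) * deriv w r)
        (-(x ^ (N - 1) * f (w x))) x := fun x hx => O.hasDerivAt_weighted (hs.trans_le hx.1)
    have hb : ∀ x ∈ Ioo s r, |-(x ^ (N - 1) * f (w x))| ≤ M := by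
      intro x hx
      have hx0 : 0 < x := hs.trans hx.1
      have h1 : x ^ (N - 1) ≤ 1 :=
        Real.rpow_le_one hx0.le (hx.2.trans hr).le (by linarith)
      have h2 := hM x ⟨hx0.le, (hx.2.trans hr).le⟩
      rw [abs_neg, abs_mul, abs_of_nonneg (Real.rpow_nonneg hx0.le _)]
      calc x ^ (N - 1) * |f (w x)| ≤ 1 * M :=
            mul_le_mul h1 h2 (abs_nonneg _) zero_le_one
        _ = M := one_mul M
    have hc : ContinuousOn (fun r => r ^ (N - 1) * deriv w r) (Icc s r) :=
      fun x hx => (hd x hx).continuousAt.continuousWithinAt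
    have h1 := sub_le_of_hasDerivAt_le hsr hc (fun x hx => hd x (Ioo_subset_Icc_self hx))
      fun x hx => (abs_le.1 (hb x hx)).2
    have h2 := le_sub_of_le_hasDerivAt hsr hc (fun x hx => hd x (Ioo_subset_Icc_self hx))
      fun x hx => (abs_le.1 (hb x hx)).1
    rw [abs_le]
    constructor <;> linarith
  refine ⟨M, fun r hr => ?_⟩
  by_contra hlt
  push Not at hlt
  set c := |r ^ (N - 1) * deriv w r| - M * r with hc
  have hc0 : 0 < c := by linarith
  -- The Lipschitz bound carries the excess `c` down to radius `0`, and `N - 1 ≥ 1` turns it into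
  -- `|w'(s)| ≥ c/s`. Then `w` varies by at least `c/2` on every `[s/2, s]`, against continuity at
  -- `0`.
  have hlow : ∀ s, 0 < s → s ≤ r → c ≤ s * |deriv w s| := by
    intro s hs hsr
    have h1 := hlip s r hs hsr hr.2
    have h2 := abs_sub_abs_le_abs_sub (r ^ (N - 1) * deriv w r) (s ^ (N - 1) * deriv w s)
    have h3 : c ≤ |s ^ (N - 1) * deriv w s| := by nlinarith
    rw [abs_mul, abs_of_nonneg (Real.rpow_nonneg hs.le _)] at h3
    refine h3.trans (mul_le_mul_of_nonneg_right ?_ (abs_nonneg _))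
    calc s ^ (N - 1) ≤ s ^ (1 : ℝ) :=
          Real.rpow_le_rpow_of_exponent_ge hs (hsr.trans hr.2.le) (by linarith)
      _ = s := Real.rpow_one s
  have hlim : Tendsto (fun s => w s - w (s / 2)) (𝓝[>] 0) (𝓝 0) := by
    have hw : Tendsto w (𝓝[>] 0) (𝓝 (w 0)) :=
      (O.continuousOn 0 (mem_Ici.2 le_rfl)).mono Ioi_subset_Ici_self
    have hhalf : Tendsto (fun s : ℝ => s / 2) (𝓝[>] 0) (𝓝[>] 0) := by
      refine tendsto_nhdsWithin_iff.2 ⟨?_, ?_⟩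
      · have : Tendsto (fun s : ℝ => s / 2) (𝓝 0) (𝓝 (0 / 2)) :=
          (continuous_id.div_const 2).tendsto 0
        rw [zero_div] at this
        exact this.mono_left nhdsWithin_le_nhds
      · filter_upwards [self_mem_nhdsWithin] with s hs using half_pos (mem_Ioi.1 hs)
    simpa using hw.sub (hw.comp hhalf)
  have hev : ∀ᶠ s in 𝓝[>] (0 : ℝ), |w s - w (s / 2)| < c / 2 := by
    have := hlim.abs
    rw [abs_zero] at this
    exact this.eventually (gt_mem_nhds (half_pos hc0))
  obtain ⟨s, hs, hsr⟩ := (hev.and (Ioo_mem_nhdsGT hr.1)).exists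
  obtain ⟨x, hx, hxe⟩ := exists_deriv_eq_slope w (show s / 2 < s by linarith [hsr.1])
    (O.continuousOn.mono fun y hy => mem_Ici.2 (by linarith [hsr.1, hy.1]))
    (fun y hy => (O.sol.diff y (by linarith [hsr.1, hy.1])).differentiableWithinAt)
  have hx0 : 0 < x := by linarith [hx.1, hsr.1]
  have h1 := hlow x hx0 (by linarith [hx.2, hsr.2])
  have h2 : w s - w (s / 2) = deriv w x * (s / 2) := by
    rw [hxe]
    have : s ≠ 0 := hsr.1.ne'
    field_simp
    ring
  rw [h2, abs_mul, abs_of_pos (half_pos hsr.1)] at hs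
  have h3 : x * |deriv w x| ≤ s * |deriv w x| :=
    mul_le_mul_of_nonneg_right hx.2.le (abs_nonneg _)
  linarith

/-- L'Hôpital's rule for `r^(N-1) w'` over `r^N`; the numerator vanishes at `0` by
`exists_weighted_bound`. -/
theorem tendsto_opJ_zero (O : Orbit N f b β α w) :
    Tendsto (fun t => -deriv w t / t) (𝓝[>] 0) (𝓝 (f α / N)) := by
  have hN := O.two_lt
  have hw : Tendsto w (𝓝[>] 0) (𝓝 (w 0)) :=
    (O.continuousOn 0 (mem_Ici.2 le_rfl)).mono Ioi_subset_Ici_self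
  rw [O.sol.init] at hw
  obtain ⟨C, hC⟩ := O.exists_weighted_bound
  have hq : Tendsto (fun r => r ^ (N - 1) * deriv w r) (𝓝[>] 0) (𝓝 0) := by
    refine squeeze_zero_norm' (a := fun r => C * r) ?_ ?_
    · filter_upwards [Ioo_mem_nhdsGT zero_lt_one] with r hr using hC r hr
    · have : Tendsto (fun r : ℝ => C * r) (𝓝 0) (𝓝 (C * 0)) :=
        (continuous_const.mul continuous_id).tendsto 0
      rw [mul_zero] at this
      exact this.mono_left nhdsWithin_le_nhds
  have hp : Tendsto (fun r : ℝ => r ^ N) (𝓝[>] 0) (𝓝 0) := by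
    have : Tendsto (fun r : ℝ => r ^ N) (𝓝 0) (𝓝 ((0 : ℝ) ^ N)) :=
      (Real.continuousAt_rpow_const 0 N (Or.inr (by linarith))).tendsto
    rw [Real.zero_rpow (by linarith)] at this
    exact this.mono_left nhdsWithin_le_nhds
  have hdiv : Tendsto (fun r : ℝ => -(r ^ (N - 1) * f (w r)) / (N * r ^ (N - 1))) (𝓝[>] 0)
      (𝓝 (-(f α / N))) := by
    have : Tendsto (fun r => -(f (w r) / N)) (𝓝[>] 0) (𝓝 (-(f α / N))) :=
      (((O.shape.cont.tendsto α).comp hw).div_const N).neg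
    refine this.congr' ?_
    filter_upwards [self_mem_nhdsWithin] with r hr
    have h1 : (r : ℝ) ^ (N - 1) ≠ 0 := (Real.rpow_pos_of_pos hr _).ne'
    have h2 : N ≠ 0 := by linarith
    field_simp
  have h := HasDerivAt.lhopital_zero_right_on_Ioo (zero_lt_one)
    (fun x hx => O.hasDerivAt_weighted hx.1)
    (fun x hx => Real.hasDerivAt_rpow_const (x := x) (p := N) (Or.inl hx.1.ne'))
    (fun x hx => (mul_pos (by linarith) (Real.rpow_pos_of_pos hx.1 _)).ne') hq hp hdiv
  have h' := h.neg
  rw [neg_neg] at h'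
  refine h'.congr' ?_
  filter_upwards [self_mem_nhdsWithin] with r hr
  have hr : 0 < r := hr
  have h1 : (r : ℝ) ^ (N - 1) ≠ 0 := (Real.rpow_pos_of_pos hr _).ne'
  have h3 : r ^ N = r ^ (N - 1) * r := by
    rw [← Real.rpow_add_one hr.ne']
    ring_nf
  rw [h3]
  field_simp

theorem opJ_zero (O : Orbit N f b β α w) : opJ w 0 = f α / N := by
  simp only [opJ, if_true]
  exact O.tendsto_opJ_zero.limUnder_eq

theorem opJ_zero_ne (O : Orbit N f b β α w) : opJ w 0 ≠ 0 := by
  rw [O.opJ_zero]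
  exact div_ne_zero O.f_init_ne (by linarith [O.two_lt])

theorem hasDerivAt_opJ (O : Orbit N f b β α w) {r : ℝ} (hr : 0 < r) :
    HasDerivAt (opJ w) ((f (w r) - N * opJ w r) / r) r := by
  have h1 : HasDerivAt (fun t => -deriv w t / t) ((f (w r) - N * opJ w r) / r) r := by
    refine ((O.sol.ode r hr).neg.div (hasDerivAt_id r) hr.ne').congr_deriv ?_
    simp only [Pi.neg_apply, id]
    rw [opJ_of_pos w hr]
    field_simp
    ring
  refine h1.congr_of_eventuallyEq ?_
  filter_upwards [lt_mem_nhds hr] with t ht using opJ_of_pos w ht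

theorem continuousOn_opJ (O : Orbit N f b β α w) : ContinuousOn (opJ w) (Ici 0) := by
  intro r hr
  rcases (mem_Ici.1 hr).eq_or_lt with rfl | h
  · rw [← continuousWithinAt_Ioi_iff_Ici, ContinuousWithinAt, O.opJ_zero]
    refine O.tendsto_opJ_zero.congr' ?_
    filter_upwards [self_mem_nhdsWithin] with t ht using (opJ_of_pos w ht).symm
  · exact (O.hasDerivAt_opJ h).continuousAt.continuousWithinAt

theorem continuousOn_curveJ (O : Orbit N f b β α w) : ContinuousOn (curveJ w) (Ici 0) :=
  O.continuousOn.prodMk O.continuousOn_opJ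

theorem hasDerivAt_slope (O : Orbit N f b β α w) {r : ℝ} (hr : 0 < r) :
    HasDerivAt (fun r => r * opJ w r) (f (w r) - (N - 1) * opJ w r) r := by
  refine ((hasDerivAt_id r).mul (O.hasDerivAt_opJ hr)).congr_deriv ?_
  simp only [id]
  field_simp
  ring

theorem continuousOn_energy (O : Orbit N f b β α w) : ContinuousOn (energy f w) (Ici 0) :=
  (((continuousOn_id.mul O.continuousOn_opJ).pow 2).div_const 2).add
    (O.shape.continuous_F.comp_continuousOn O.continuousOn)

theorem hasDerivAt_energy (O : Orbit N f b β α w) {r : ℝ} (hr : 0 < r) :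
    HasDerivAt (energy f w) (-((N - 1) * r * opJ w r ^ 2)) r := by
  have h1 := (((O.hasDerivAt_slope hr).pow 2).div_const 2).add
    ((O.shape.hasDerivAt_F (w r)).comp r (O.hasDerivAt hr))
  refine h1.congr_deriv ?_
  push_cast
  ring

/-- The friction term dissipates: `E' = -(N-1) r 𝒥² ≤ 0`. -/
theorem antitoneOn_energy (O : Orbit N f b β α w) : AntitoneOn (energy f w) (Ici 0) := by
  refine antitoneOn_of_deriv_nonpos (convex_Ici 0) O.continuousOn_energy ?_ ?_
  · rw [interior_Ici]
    exact fun x hx => (O.hasDerivAt_energy hx).differentiableAt.differentiableWithinAt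
  · rw [interior_Ici]
    intro x hx
    rw [(O.hasDerivAt_energy hx).deriv]
    have : 0 ≤ (N - 1) * x * opJ w x ^ 2 :=
      mul_nonneg (mul_nonneg (by linarith [O.two_lt]) (le_of_lt hx)) (sq_nonneg _)
    linarith

theorem energy_zero (O : Orbit N f b β α w) : energy f w 0 = primF f α := by
  simp [energy, O.sol.init]

theorem F_le_energy (r : ℝ) : primF f (w r) ≤ energy f w r := by
  unfold energy
  nlinarith [sq_nonneg (r * opJ w r)]

theorem energy_le_init (O : Orbit N f b β α w) {r : ℝ} (hr : 0 ≤ r) :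
    energy f w r ≤ primF f α := by
  rw [← O.energy_zero]
  exact O.antitoneOn_energy (mem_Ici.2 le_rfl) hr hr

theorem F_b_le_energy (O : Orbit N f b β α w) (r : ℝ) : primF f b ≤ energy f w r :=
  (O.shape.F_b_le _).trans (F_le_energy r)

theorem abs_le (O : Orbit N f b β α w) {r : ℝ} (hr : 0 ≤ r) : |w r| ≤ |α| :=
  O.shape.F_le_imp_abs_le O.b_lt_abs.le ((F_le_energy r).trans (O.energy_le_init hr))

theorem exists_slope_bound (O : Orbit N f b β α w) :
    ∃ M, 0 < M ∧ ∀ r, 0 ≤ r → |r * opJ w r| ≤ M := by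
  have h0 : 0 < 2 * (primF f α - primF f b) := by
    have := O.shape.F_b_lt O.b_lt_abs.ne'
    linarith
  refine ⟨√(2 * (primF f α - primF f b)), Real.sqrt_pos.2 h0, fun r hr => ?_⟩
  refine Real.abs_le_sqrt ?_
  have h1 := O.energy_le_init hr
  have h2 := O.shape.F_b_le (w r)
  unfold energy at h1
  linarith

/-- The equilibria `±b` are not reached in finite time. -/
theorem F_b_lt_energy (O : Orbit N f b β α w) {r : ℝ} (hr : 0 ≤ r) :
    primF f b < energy f w r := by
  have hN := O.two_lt
  have h0 : primF f b < energy f w 0 := by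
    rw [O.energy_zero]
    exact O.shape.F_b_lt O.b_lt_abs.ne'
  rcases hr.eq_or_lt with rfl | hr
  · exact h0
  have hev : ∀ᶠ s in 𝓝[>] (0 : ℝ), primF f b < energy f w s := by
    have : Tendsto (energy f w) (𝓝[>] 0) (𝓝 (energy f w 0)) :=
      (O.continuousOn_energy 0 (mem_Ici.2 le_rfl)).mono Ioi_subset_Ici_self
    exact this.eventually (lt_mem_nhds h0)
  obtain ⟨s, hs, hsr⟩ := (hev.and (Ioo_mem_nhdsGT hr)).exists
  -- Grönwall: `y²/2 ≤ E - F(b)` gives `E' ≥ -C (E - F(b))` on `[s, r]`. The rate `2(N-1)/x` is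
  -- singular at `0`, hence the start at some `s > 0` where continuity already provides a positive
  -- gap.
  set C := 2 * (N - 1) / s with hC
  have hmono : MonotoneOn (fun t => Real.exp (C * t) * (energy f w t - primF f b)) (Icc s r) := by
    have hd : ∀ x ∈ Icc s r, HasDerivAt (fun t => Real.exp (C * t) * (energy f w t - primF f b))
        (Real.exp (C * x) * (C * (energy f w x - primF f b) - (N - 1) * x * opJ w x ^ 2)) x := by
      intro x hx
      have hx0 : 0 < x := hsr.1.trans_le hx.1
      have h1 : HasDerivAt (fun t => Real.exp (C * t)) (Real.exp (C * x) * (C * 1)) x :=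
        ((hasDerivAt_id x).const_mul C).exp
      refine (h1.mul ((O.hasDerivAt_energy hx0).sub_const (primF f b))).congr_deriv ?_
      ring
    refine monotoneOn_of_deriv_nonneg (convex_Icc s r)
      (fun x hx => (hd x hx).continuousAt.continuousWithinAt) ?_ ?_
    · rw [interior_Icc]
      exact fun x hx =>
        (hd x (Ioo_subset_Icc_self hx)).differentiableAt.differentiableWithinAt
    · rw [interior_Icc]
      intro x hx
      rw [(hd x (Ioo_subset_Icc_self hx)).deriv]
      refine mul_nonneg (Real.exp_pos _).le ?_
      have h2 : (x * opJ w x) ^ 2 / 2 ≤ energy f w x - primF f b := by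
        have := O.shape.F_b_le (w x)
        unfold energy
        linarith
      have h3 : C * ((x * opJ w x) ^ 2 / 2) ≤ C * (energy f w x - primF f b) :=
        mul_le_mul_of_nonneg_left h2 (div_nonneg (by linarith) hsr.1.le)
      have h4 : (N - 1) * x * opJ w x ^ 2 ≤ C * ((x * opJ w x) ^ 2 / 2) := by
        have h5 : C * ((x * opJ w x) ^ 2 / 2) = ((N - 1) * x * opJ w x ^ 2) * (x / s) := by
          rw [hC]
          have := hsr.1.ne'
          field_simp
        rw [h5]
        refine le_mul_of_one_le_right ?_ ((one_le_div hsr.1).2 hx.1.le)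
        have : 0 < x := hsr.1.trans hx.1
        have : 0 ≤ N - 1 := by linarith
        positivity
      linarith
  have h1 := hmono ⟨le_rfl, hsr.2.le⟩ ⟨hsr.2.le, le_rfl⟩ hsr.2.le
  have h2 : 0 < Real.exp (C * s) * (energy f w s - primF f b) :=
    mul_pos (Real.exp_pos _) (by linarith)
  have h3 := pos_of_mul_pos_right (h2.trans_le h1) (Real.exp_pos _).le
  linarith

/-- At such a point the energy would equal its excluded minimum `F(b)`. -/
theorem abs_ne_b (O : Orbit N f b β α w) {r : ℝ} (hr : 0 ≤ r) (hJ : opJ w r = 0) :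
    |w r| ≠ b := by
  intro h
  have := O.F_b_lt_energy hr
  unfold energy at this
  rw [hJ, ← O.shape.F_abs (w r), h] at this
  simp at this

theorem f_ne_zero (O : Orbit N f b β α w) {r : ℝ} (hr : 0 ≤ r) (hJ : opJ w r = 0)
    (h0 : w r ≠ 0) : f (w r) ≠ 0 := by
  rw [Ne, O.shape.f_eq_zero_iff]
  rintro (h | h)
  · exact h0 h
  · exact O.abs_ne_b hr hJ h

/-- Constant energy on an interval forces `𝒥 = 0` there, then `f(w) = 0`. The equilibria `±b` being
excluded, only `w = 0` remains, and by continuity the curve is already at the origin at `r₁`. -/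
theorem energy_strict (O : Orbit N f b β α w) {r₁ r₂ : ℝ} (h1 : 0 ≤ r₁) (h12 : r₁ < r₂)
    (hne : curveJ w r₁ ≠ 0) : energy f w r₂ < energy f w r₁ := by
  have hN := O.two_lt
  refine lt_of_le_of_ne (O.antitoneOn_energy h1 (h1.trans h12.le) h12.le) fun heq => hne ?_
  have hconst : ∀ x ∈ Ioo r₁ r₂, energy f w x = energy f w r₁ := by
    intro x hx
    have hx0 : 0 ≤ x := h1.trans hx.1.le
    refine le_antisymm (O.antitoneOn_energy h1 hx0 hx.1.le) ?_
    rw [← heq]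
    exact O.antitoneOn_energy hx0 (h1.trans h12.le) hx.2.le
  have hJ : ∀ x ∈ Ioo r₁ r₂, opJ w x = 0 := by
    intro x hx
    have hx0 : 0 < x := h1.trans_lt hx.1
    have h2 : HasDerivAt (energy f w) 0 x := by
      refine (hasDerivAt_const x (energy f w r₁)).congr_of_eventuallyEq ?_
      filter_upwards [Ioo_mem_nhds hx.1 hx.2] with y hy using hconst y hy
    have h3 := (O.hasDerivAt_energy hx0).unique h2
    have h4 : (N - 1) * x * opJ w x ^ 2 = 0 := by linarith
    have h5 : (N - 1) * x ≠ 0 := (mul_pos (by linarith) hx0).ne'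
    simpa [h5] using h4
  have hw : ∀ x ∈ Ioo r₁ r₂, w x = 0 := by
    intro x hx
    have hx0 : 0 < x := h1.trans_lt hx.1
    by_contra hwx
    refine O.f_ne_zero hx0.le (hJ x hx) hwx ?_
    have h2 : HasDerivAt (opJ w) 0 x := by
      refine (hasDerivAt_const x (0 : ℝ)).congr_of_eventuallyEq ?_
      filter_upwards [Ioo_mem_nhds hx.1 hx.2] with y hy using hJ y hy
    have h3 := (O.hasDerivAt_opJ hx0).unique h2
    rw [hJ x hx, mul_zero, sub_zero, div_eq_zero_iff] at h3
    exact h3.resolve_right hx0.ne'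
  have hlim : Tendsto (curveJ w) (𝓝[>] r₁) (𝓝 (curveJ w r₁)) :=
    (O.continuousOn_curveJ r₁ h1).mono fun y hy => mem_Ici.2 (h1.trans (le_of_lt hy))
  refine tendsto_nhds_unique hlim ?_
  refine tendsto_const_nhds.congr' ?_
  filter_upwards [Ioo_mem_nhdsGT h12] with x hx
  rw [curveJ, hJ x hx, hw x hx]
  rfl

/-- On every vertical line the orbit moves inwards. -/
theorem abs_opJ_lt (O : Orbit N f b β α w) {r₁ r₂ : ℝ} (h1 : 0 ≤ r₁) (h12 : r₁ < r₂)
    (hne : curveJ w r₁ ≠ 0) (heq : w r₁ = w r₂) : |opJ w r₂| < |opJ w r₁| := by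
  have h := O.energy_strict h1 h12 hne
  unfold energy at h
  rw [heq] at h
  have h2 : (r₂ * opJ w r₂) ^ 2 < (r₁ * opJ w r₁) ^ 2 := by linarith
  have h3 := sq_lt_sq.1 h2
  rw [abs_mul, abs_mul, abs_of_nonneg h1, abs_of_nonneg (h1.trans h12.le)] at h3
  by_contra hle
  push Not at hle
  have h4 : r₁ * |opJ w r₁| ≤ r₂ * |opJ w r₂| :=
    mul_le_mul h12.le hle (abs_nonneg _) (h1.trans h12.le)
  linarith

theorem injOn_curveJ (O : Orbit N f b β α w) :
    InjOn (curveJ w) {r | 0 ≤ r ∧ curveJ w r ≠ 0} := by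
  have key : ∀ r₁ r₂, 0 ≤ r₁ → curveJ w r₁ ≠ 0 → curveJ w r₁ = curveJ w r₂ → ¬ r₁ < r₂ := by
    intro r₁ r₂ h1 hne heq h12
    have hw : w r₁ = w r₂ := congrArg Prod.fst heq
    have hJ : opJ w r₁ = opJ w r₂ := congrArg Prod.snd heq
    have := O.abs_opJ_lt h1 h12 hne hw
    rw [hJ] at this
    exact lt_irrefl _ this
  intro r₁ h₁ r₂ h₂ heq
  exact le_antisymm (not_lt.1 (key r₂ r₁ h₂.1 h₂.2 heq.symm)) (not_lt.1 (key r₁ r₂ h₁.1 h₁.2 heq))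

theorem curveJ_eq_zero_iff (r : ℝ) : curveJ w r = 0 ↔ w r = 0 ∧ opJ w r = 0 := by
  simp [curveJ, Prod.ext_iff]

theorem curveJ_zero_ne (O : Orbit N f b β α w) : curveJ w 0 ≠ 0 := by
  rw [Ne, curveJ_eq_zero_iff]
  exact fun h => O.opJ_zero_ne h.2

/-- After a double zero the orbit rests at the origin. -/
theorem curveJ_eq_zero_of_le (O : Orbit N f b β α w) {r s : ℝ} (hr : 0 ≤ r) (hrs : r ≤ s)
    (h : curveJ w r = 0) : curveJ w s = 0 := by
  have hr0 : 0 < r := by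
    refine hr.lt_of_ne ?_
    rintro rfl
    exact O.curveJ_zero_ne h
  rcases hrs.eq_or_lt with rfl | hrs
  · exact h
  rw [curveJ_eq_zero_iff] at h
  have hz := O.sol.zero_ext r hr0 h.1 (by rw [deriv_eq_opJ w hr0, h.2]; simp)
  have hs : 0 < s := hr0.trans hrs
  have hd : HasDerivAt w 0 s := by
    refine (hasDerivAt_const s (0 : ℝ)).congr_of_eventuallyEq ?_
    filter_upwards [lt_mem_nhds hrs] with y hy using hz y hy.le
  rw [curveJ_eq_zero_iff]
  refine ⟨hz s hrs.le, ?_⟩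
  rw [opJ_of_pos w hs, hd.deriv]
  simp

theorem curveJ_ne_zero_of_energy_pos {r : ℝ} (h : 0 < energy f w r) : curveJ w r ≠ 0 := by
  rw [Ne, curveJ_eq_zero_iff]
  rintro ⟨h1, h2⟩
  unfold energy at h
  rw [h1, h2, Shape.F_zero] at h
  simp at h

theorem le_abs_of_energy_nonneg (O : Orbit N f b β α w) {r : ℝ} (h : 0 ≤ energy f w r)
    (hJ : opJ w r = 0) (h0 : w r ≠ 0) : β ≤ |w r| := by
  by_contra hlt
  have := O.shape.F_lt_zero h0 (not_le.1 hlt)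
  unfold energy at h
  rw [hJ] at h
  simp at h
  linarith

/-- The reflected orbit is assumed only for the radius `0`, where `𝒥` is defined by a limit. -/
theorem opJ_const_mul (O : Orbit N f b β α w) {σ : ℝ} (O' : Orbit N f b β (σ * α) fun r => σ * w r)
    (hσ : σ = 1 ∨ σ = -1) {r : ℝ} (hr : 0 ≤ r) : opJ (fun r => σ * w r) r = σ * opJ w r := by
  rcases hr.eq_or_lt with rfl | hr
  · rw [O.opJ_zero, O'.opJ_zero]
    rcases hσ with rfl | rfl
    · simp
    · simp [O.shape.odd]
      ring
  · rw [opJ_of_pos _ hr, opJ_of_pos _ hr, deriv_const_mul_field]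
    ring

/-- Oddness of `f`. With `σ = (-1)^k` it allows every local analysis to be done on the side `w > 0`;
this is why `Orbit` bounds `|α|` instead of `α`. -/
theorem const_mul (O : Orbit N f b β α w) {σ : ℝ} (hσ : σ = 1 ∨ σ = -1) :
    Orbit N f b β (σ * α) fun r => σ * w r := by
  have hf : ∀ s, f (σ * s) = σ * f s := by
    intro s
    rcases hσ with rfl | rfl
    · simp
    · simp [O.shape.odd]
  have hσ0 : σ ≠ 0 := by rcases hσ with rfl | rfl <;> norm_num
  refine ⟨O.two_lt, O.shape, ⟨by simp [O.sol.init], ?_, ?_, ?_, ?_⟩, ?_⟩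
  · have := O.sol.init_deriv.const_mul σ
    rwa [mul_zero] at this
  · exact fun r hr => (O.sol.diff r hr).const_mul σ
  · intro r hr
    have h1 : deriv (fun r => σ * w r) = fun r => σ * deriv w r := by
      ext r
      rw [deriv_const_mul_field]
    rw [h1]
    refine ((O.sol.ode r hr).const_mul σ).congr_deriv ?_
    rw [hf]
    ring
  · intro r₀ hr₀ h1 h2 r hr
    rw [deriv_const_mul_field] at h2
    simp only [mul_eq_zero, hσ0, false_or] at h1 h2 ⊢
    exact O.sol.zero_ext r₀ hr₀ h1 h2 r hr
  · have := O.le_abs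
    rcases hσ with rfl | rfl <;> simpa using this

end Orbit

/-! ### Polar angles, spiralling and winding -/

/-- A plane curve over a convex parameter set avoiding `(c, 0)` has a continuous polar angle. -/
theorem exists_isPolar {γ : ℝ → ℝ × ℝ} {c : ℝ} {A : Set ℝ} (hA : Convex ℝ A)
    (hne : A.Nonempty) (hγ : ContinuousOn γ A) (hc : ∀ r ∈ A, γ r ≠ (c, 0)) :
    ∃ ρ θ : ℝ → ℝ, IsPolar γ c A ρ θ := by
  classical
  have : LocallyPathConnectedSpace A := hA.locallyPathConnectedSpace
  have : ContractibleSpace A := hA.contractibleSpace hne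
  obtain ⟨a, ha⟩ := hne
  let g : ℝ → ℂ := fun r => ⟨(γ r).1 - c, (γ r).2⟩
  have hg : ContinuousOn g A := by
    have h1 : ContinuousOn (fun r => (((γ r).1 - c : ℝ) : ℂ) + ((γ r).2 : ℝ) * Complex.I) A := by
      have := continuous_fst.comp_continuousOn hγ
      have h2 := continuous_snd.comp_continuousOn hγ
      exact (Complex.continuous_ofReal.comp_continuousOn (this.sub continuousOn_const)).add
        ((Complex.continuous_ofReal.comp_continuousOn h2).mul continuousOn_const)
    refine h1.congr fun r _ => ?_
    exact Complex.mk_eq_add_mul_I _ _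
  have hg0 : ∀ r ∈ A, g r ≠ 0 := by
    intro r hr h
    refine hc r hr (Prod.ext ?_ (congrArg Complex.im h))
    have := congrArg Complex.re h
    simp only [g, Complex.zero_re] at this
    simp only
    linarith
  -- The translated curve is lifted through the covering `exp : ℂ → ℂ \ {0}`, which is possible
  -- since the convex set `A` is contractible. The imaginary part of the lift is the angle, the
  -- exponential of its real part the radius.
  obtain ⟨G, ⟨-, hG⟩, -⟩ := Complex.isCoveringMapOn_exp.existsUnique_continuousMap_lifts
    (⟨A.domRestrict g, continuousOn_iff_continuous_domRestrict.mp hg⟩ : C(A, ℂ))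
    (a₀ := ⟨a, ha⟩) (Complex.exp_log (hg0 a ha)) (fun r => hg0 r r.2)
  have hG' : ∀ r : A, Complex.exp (G r) = g r := fun r => congrFun hG r
  refine ⟨fun r => if hr : r ∈ A then Real.exp (G ⟨r, hr⟩).re else 1,
    fun r => if hr : r ∈ A then (G ⟨r, hr⟩).im else 0, ?_, ?_⟩
  · rw [continuousOn_iff_continuous_domRestrict]
    have : Continuous fun r : A => (G r).im := Complex.continuous_im.comp G.continuous
    convert! this using 2 with r
    simp [Set.domRestrict]
  · intro r hr
    simp only [hr, dif_pos]
    refine ⟨Real.exp_pos _, ?_⟩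
    have h1 := hG' ⟨r, hr⟩
    have hre := congrArg Complex.re h1
    have him := congrArg Complex.im h1
    rw [Complex.exp_re] at hre
    rw [Complex.exp_im] at him
    simp only [g] at hre him
    refine Prod.ext ?_ ?_
    · simp only
      linarith
    · exact him.symm

/-- A continuous function that changes from negative to positive at each of its zeros is positive
after every point where it is nonnegative. -/
theorem pos_of_nonneg_of_crossing {g : ℝ → ℝ} {r₁ r₂ : ℝ} (h12 : r₁ < r₂)
    (hc : ContinuousOn g (Icc r₁ r₂)) (h1 : 0 ≤ g r₁)
    (hz : ∀ r ∈ Icc r₁ r₂, g r = 0 → ∃ ε > 0, (∀ s ∈ Ioo (r - ε) r ∩ Icc r₁ r₂, g s < 0) ∧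
      ∀ s ∈ Ioo r (r + ε) ∩ Icc r₁ r₂, 0 < g s) : 0 < g r₂ := by
  by_contra hle
  push Not at hle
  obtain ⟨p, hp, hgp⟩ : ∃ p ∈ Ico r₁ r₂, 0 ≤ g p := ⟨r₁, ⟨le_rfl, h12⟩, h1⟩
  obtain ⟨q, hq, hpq, hgq⟩ : ∃ q ∈ Ioc r₁ r₂, r₁ < q ∧ g q < 0 := by
    rcases hle.eq_or_lt with h | h
    · obtain ⟨ε, hε, hl, -⟩ := hz r₂ ⟨h12.le, le_rfl⟩ h
      have hm : max ((r₁ + r₂) / 2) (r₂ - ε / 2) < r₂ := max_lt (by linarith) (by linarith)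
      have hm1 : r₁ < max ((r₁ + r₂) / 2) (r₂ - ε / 2) :=
        lt_max_of_lt_left (by linarith)
      exact ⟨_, ⟨hm1, hm.le⟩, hm1,
        hl _ ⟨⟨lt_max_of_lt_right (by linarith), hm⟩, hm1.le, hm.le⟩⟩
    · exact ⟨r₂, ⟨h12, le_rfl⟩, h12, h⟩
  have hsub : Icc r₁ q ⊆ Icc r₁ r₂ := Icc_subset_Icc_right hq.2
  -- The last point before `q` with `g ≥ 0` is a zero followed by negative values, contrary to the
  -- assumed direction of crossing.
  set S : Set ℝ := Icc r₁ q ∩ g ⁻¹' Ici 0 with hS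
  have hScl : IsClosed S :=
    (hc.mono hsub).preimage_isClosed_of_isClosed isClosed_Icc isClosed_Ici
  have hSne : S.Nonempty := ⟨r₁, ⟨le_rfl, hpq.le⟩, h1⟩
  have hSb : BddAbove S := ⟨q, fun x hx => hx.1.2⟩
  obtain ⟨hs1, hs2⟩ := hScl.csSup_mem hSne hSb
  set s := sSup S
  have hs2 : 0 ≤ g s := hs2
  have hsq : s < q := by
    refine lt_of_le_of_ne hs1.2 fun h => ?_
    rw [h] at hs2
    linarith
  have hafter : ∀ x ∈ Ioc s q, g x < 0 := by
    intro x hx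
    by_contra hx0
    exact absurd (le_csSup hSb (show x ∈ S from ⟨⟨hs1.1.trans hx.1.le, hx.2⟩, not_lt.1 hx0⟩))
      (not_le.2 hx.1)
  have hs0 : g s = 0 := by
    refine le_antisymm ?_ hs2
    obtain ⟨t, ht, hgt⟩ : (0 : ℝ) ∈ g '' Icc s q :=
      intermediate_value_Icc' hsq.le (hc.mono fun x hx => ⟨hs1.1.trans hx.1, hx.2.trans hq.2⟩)
        ⟨hgq.le, hs2⟩
    rcases ht.1.eq_or_lt with h | h
    · rw [h, hgt]
    · exact absurd hgt (hafter t ⟨h, ht.2⟩).ne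
  obtain ⟨ε, hε, -, hr⟩ := hz s (hsub hs1) hs0
  have hm : s < min ((s + q) / 2) (s + ε / 2) := lt_min (by linarith) (by linarith)
  have hmq : min ((s + q) / 2) (s + ε / 2) < q := min_lt_of_left_lt (by linarith)
  have h3 := hr _ ⟨⟨hm, min_lt_of_right_lt (by linarith)⟩, hs1.1.trans hm.le, hmq.le.trans hq.2⟩
  have h4 := hafter _ ⟨hm, hmq.le⟩
  linarith

/-- At multiples of `π/2` the sine and cosine are `0` and `±1`. -/
theorem sin_mul_cos_int_mul_pi_div_two (m : ℤ) :
    Real.sin (m * (Real.pi / 2)) * Real.cos (m * (Real.pi / 2)) = 0 := by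
  have h := Real.sin_int_mul_pi m
  have h2 : (m : ℝ) * Real.pi = 2 * (m * (Real.pi / 2)) := by ring
  rw [h2, Real.sin_two_mul] at h
  linarith

/-- The second coordinate in axes rotated by `φ`. Near the half-axis of angle `φ` its sign is the
sign of `θ - φ`, and it is differentiable although `θ` is only known to be continuous. -/
theorem isPolar_sin_sub {γ : ℝ → ℝ × ℝ} {c : ℝ} {A : Set ℝ} {ρ θ : ℝ → ℝ}
    (h : IsPolar γ c A ρ θ) {r : ℝ} (hr : r ∈ A) (φ : ℝ) :
    (γ r).2 * Real.cos φ - ((γ r).1 - c) * Real.sin φ = ρ r * Real.sin (θ r - φ) := by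
  rw [(h.2 r hr).2, Real.sin_sub]
  ring

namespace Orbit

variable {N : ℝ} {f : ℝ → ℝ} {b β α : ℝ} {w : ℝ → ℝ}

/-- The half-axes issuing from `(c, 0)` are crossed only in the direction of increasing angle. -/
theorem angle_lt (O : Orbit N f b β α w) {c : ℝ} {A : Set ℝ} (hA : Convex ℝ A)
    (hA0 : A ⊆ Ici 0) (hc : w 0 ≠ c) (hJ : ∀ r ∈ A, opJ w r = 0 → 0 < (w r - c) * f (w r))
    {ρ θ : ℝ → ℝ} (hp : IsPolar (curveJ w) c A ρ θ) {r₁ r₂ : ℝ} (h1 : r₁ ∈ A) (h2 : r₂ ∈ A)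
    (h12 : r₁ < r₂) (m : ℤ) (hm : m * (Real.pi / 2) ≤ θ r₁) : m * (Real.pi / 2) < θ r₂ := by
  have hsub : Icc r₁ r₂ ⊆ A := hA.ordConnected.out h1 h2
  set φ : ℝ := m * (Real.pi / 2) with hφ
  have key : 0 < θ r₂ - φ := by
    refine pos_of_nonneg_of_crossing (g := fun r => θ r - φ) h12
      ((hp.1.mono hsub).sub continuousOn_const) (by linarith) fun r hr hr0 => ?_
    have hrA := hsub hr
    have hθ : θ r = φ := by linarith
    obtain ⟨hρ, hγ⟩ := hp.2 r hrA
    have hw : w r = c + ρ r * Real.cos φ := by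
      have := congrArg Prod.fst hγ
      rwa [hθ] at this
    have hJr : opJ w r = ρ r * Real.sin φ := by
      have := congrArg Prod.snd hγ
      rwa [hθ] at this
    have hsc := sin_mul_cos_int_mul_pi_div_two m
    rw [← hφ] at hsc
    have hs2 := Real.sin_sq_add_cos_sq φ
    -- The initial point lies on none of the four half-axes, since `𝒥(0) ≠ 0` and `w(0) ≠ c`; so the
    -- differential equation is available.
    have hr0 : 0 < r := by
      refine lt_of_le_of_ne (hA0 hrA) ?_
      rintro rfl
      rcases mul_eq_zero.1 hsc with h | h
      · rw [h, mul_zero] at hJr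
        exact O.opJ_zero_ne hJr
      · rw [h, mul_zero, add_zero] at hw
        exact hc hw
    have hd : HasDerivAt (fun r => opJ w r * Real.cos φ - (w r - c) * Real.sin φ)
        ((f (w r) - N * opJ w r) / r * Real.cos φ - -(r * opJ w r) * Real.sin φ) r :=
      ((O.hasDerivAt_opJ hr0).mul_const _).sub (((O.hasDerivAt hr0).sub_const c).mul_const _)
    -- On a horizontal half-axis the derivative is `f(w) cos φ / r`, whose sign is supplied by `hJ`;
    -- on a vertical one it is `r ρ`.
    have hpos : 0 < (f (w r) - N * opJ w r) / r * Real.cos φ - -(r * opJ w r) * Real.sin φ := by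
      rcases mul_eq_zero.1 hsc with h | h
      · have h3 := hJ r hrA (by rw [hJr, h, mul_zero])
        rw [hJr, h]
        have h4 : 0 < (ρ r * Real.cos φ) * f (w r) := by
          have : w r - c = ρ r * Real.cos φ := by linarith
          rwa [this] at h3
        have h5 : 0 < Real.cos φ * f (w r) := by
          refine pos_of_mul_pos_right (a := ρ r) ?_ hρ.le
          linarith
        have h6 : (f (w r) - N * (ρ r * 0)) / r * Real.cos φ - -(r * (ρ r * 0)) * 0 =
            (Real.cos φ * f (w r)) / r := by ring
        rw [h6]
        exact div_pos h5 hr0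
      · rw [hJr, h]
        rw [h] at hs2
        have h6 : (f (w r) - N * (ρ r * Real.sin φ)) / r * 0 -
            -(r * (ρ r * Real.sin φ)) * Real.sin φ = r * ρ r * (Real.sin φ ^ 2 + 0 ^ 2) := by ring
        rw [h6, hs2]
        have := mul_pos hr0 hρ
        linarith
    have hzero : (fun r => opJ w r * Real.cos φ - (w r - c) * Real.sin φ) r = 0 := by
      have := isPolar_sin_sub hp hrA φ
      simp only [curveJ] at this
      simp only
      rw [this, hθ, sub_self, Real.sin_zero, mul_zero]
    obtain ⟨ε, hε, hneg, hpos'⟩ := hd.eventually_sign_of_pos hpos hzero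
    have hcont : ContinuousWithinAt θ A r := hp.1 r hrA
    -- Within distance `π` of `φ`, the sign of `sin (θ - φ)` determines that of `θ - φ`.
    obtain ⟨δ, hδ, hclose⟩ := Metric.continuousWithinAt_iff.1 hcont Real.pi Real.pi_pos
    refine ⟨min ε δ, lt_min hε hδ, ?_, ?_⟩
    · rintro s ⟨hs, hsI⟩
      have hsA := hsub hsI
      have h3 := hneg s ⟨by linarith [hs.1, min_le_left ε δ], hs.2⟩
      have h4 := hclose hsA (by
        rw [Real.dist_eq, abs_lt]
        constructor <;> linarith [hs.1, hs.2, min_le_right ε δ])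
      rw [Real.dist_eq, hθ, abs_lt] at h4
      have h5 := isPolar_sin_sub hp hsA φ
      simp only [curveJ] at h5
      rw [h5] at h3
      by_contra hge
      have h6 := Real.sin_nonneg_of_nonneg_of_le_pi (x := θ s - φ) (not_lt.1 hge) h4.2.le
      exact absurd h3 (not_lt.2 (mul_nonneg (hp.2 s hsA).1.le h6))
    · rintro s ⟨hs, hsI⟩
      have hsA := hsub hsI
      have h3 := hpos' s ⟨hs.1, by linarith [hs.2, min_le_left ε δ]⟩
      have h4 := hclose hsA (by
        rw [Real.dist_eq, abs_lt]
        constructor <;> linarith [hs.1, hs.2, min_le_right ε δ])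
      rw [Real.dist_eq, hθ, abs_lt] at h4
      have h5 := isPolar_sin_sub hp hsA φ
      simp only [curveJ] at h5
      rw [h5] at h3
      by_contra hle
      have h6 := Real.sin_nonpos_of_nonpos_of_neg_pi_le (x := θ s - φ) (not_lt.1 hle) h4.1.le
      exact absurd h3 (not_lt.2 (mul_nonpos_of_nonneg_of_nonpos (hp.2 s hsA).1.le h6))
  linarith

theorem exists_polar (O : Orbit N f b β α w) {c : ℝ} {A : Set ℝ} (hA : Convex ℝ A)
    (hne : A.Nonempty) (hA0 : A ⊆ Ici 0)
    (hJ : ∀ r ∈ A, opJ w r = 0 → 0 < (w r - c) * f (w r)) :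
    ∃ ρ θ : ℝ → ℝ, IsPolar (curveJ w) c A ρ θ := by
  refine exists_isPolar hA hne (O.continuousOn_curveJ.mono hA0) fun r hr h => ?_
  have h1 := hJ r hr (congrArg Prod.snd h)
  rw [show w r = c from congrArg Prod.fst h] at h1
  simp at h1

/-- A criterion for inward counterclockwise spiralling about `(c, 0)`. -/
theorem spiralsInAbout (O : Orbit N f b β α w) {c : ℝ} {A : Set ℝ} (hA : Convex ℝ A)
    (hne : A.Nonempty) (hA0 : A ⊆ Ici 0) (hc : w 0 ≠ c)
    (hJ : ∀ r ∈ A, opJ w r = 0 → 0 < (w r - c) * f (w r))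
    (hin : ∀ r₁ ∈ A, ∀ r₂ ∈ A, r₁ < r₂ → opJ w r₁ = 0 → opJ w r₂ = 0 →
      0 < (w r₁ - c) * (w r₂ - c) → |w r₂ - c| < |w r₁ - c|) :
    SpiralsInAbout (curveJ w) c A := by
  obtain ⟨ρ, θ, hp⟩ := O.exists_polar hA hne hA0 hJ
  refine ⟨ρ, θ, hp, fun r₁ h1 r₂ h2 h12 m hm => O.angle_lt hA hA0 hc hJ hp h1 h2 h12 m hm, ?_⟩
  intro r₁ h1 r₂ h2 h12 m n hθ1 hθ2
  obtain ⟨hρ1, hγ1⟩ := hp.2 r₁ h1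
  obtain ⟨hρ2, hγ2⟩ := hp.2 r₂ h2
  rw [hθ2, Real.cos_add_int_mul_two_pi, Real.sin_add_int_mul_two_pi] at hγ2
  have hw1 : w r₁ - c = ρ r₁ * Real.cos (θ r₁) := by
    have := congrArg Prod.fst hγ1
    simp only [curveJ] at this
    linarith
  have hw2 : w r₂ - c = ρ r₂ * Real.cos (θ r₁) := by
    have := congrArg Prod.fst hγ2
    simp only [curveJ] at this
    linarith
  have hJ1 : opJ w r₁ = ρ r₁ * Real.sin (θ r₁) := congrArg Prod.snd hγ1
  have hJ2 : opJ w r₂ = ρ r₂ * Real.sin (θ r₁) := congrArg Prod.snd hγ2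
  have hsc := sin_mul_cos_int_mul_pi_div_two m
  rw [← hθ1] at hsc
  have hs2 := Real.sin_sq_add_cos_sq (θ r₁)
  rcases mul_eq_zero.1 hsc with h | h
  · rw [h, mul_zero] at hJ1 hJ2
    have hcos : 0 < |Real.cos (θ r₁)| := by
      refine abs_pos.2 fun h0 => ?_
      rw [h, h0] at hs2
      norm_num at hs2
    have h3 := hin r₁ h1 r₂ h2 h12 hJ1 hJ2 (by
      rw [hw1, hw2]
      have : 0 < Real.cos (θ r₁) ^ 2 := by
        rw [h] at hs2
        linarith
      have := mul_pos (mul_pos hρ1 hρ2) this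
      linarith)
    rw [hw1, hw2, abs_mul, abs_mul, abs_of_pos hρ1, abs_of_pos hρ2] at h3
    exact lt_of_mul_lt_mul_right h3 hcos.le
  -- On a vertical half-axis both points have `w = c`, so `abs_opJ_lt` applies; only the horizontal
  -- case needs `hin`.
  · rw [h, mul_zero] at hw1 hw2
    have hsin : 0 < |Real.sin (θ r₁)| := by
      refine abs_pos.2 fun h0 => ?_
      rw [h, h0] at hs2
      norm_num at hs2
    have h3 := O.abs_opJ_lt (hA0 h1) h12 (by
      rw [Ne, curveJ_eq_zero_iff]
      rintro ⟨-, h0⟩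
      rw [hJ1] at h0
      exact (mul_ne_zero hρ1.ne' (abs_pos.1 hsin)) h0) (by linarith)
    rw [hJ1, hJ2, abs_mul, abs_mul, abs_of_pos hρ1, abs_of_pos hρ2] at h3
    exact lt_of_mul_lt_mul_right h3 hsin.le

/-- If the horizontal axis is met infinitely often, then the polar angle tends to `+∞`. -/
theorem windsForeverAbout (O : Orbit N f b β α w) {c R : ℝ} (hR : 0 ≤ R) (hc : w 0 ≠ c)
    (hJ : ∀ r ∈ Ici R, opJ w r = 0 → 0 < (w r - c) * f (w r))
    (hinf : {r | R < r ∧ opJ w r = 0}.Infinite) : WindsForeverAbout (curveJ w) c R := by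
  have hA0 : Ici R ⊆ Ici 0 := Ici_subset_Ici.2 hR
  obtain ⟨ρ, θ, hp⟩ := O.exists_polar (convex_Ici R) ⟨R, mem_Ici.2 le_rfl⟩ hA0 hJ
  have hlt := fun r₁ h1 r₂ h2 h12 m hm =>
    O.angle_lt (r₁ := r₁) (r₂ := r₂) (convex_Ici R) hA0 hc hJ hp h1 h2 h12 m hm
  refine ⟨ρ, θ, hp, ?_⟩
  have hint : ∀ r ∈ {r | R < r ∧ opJ w r = 0}, ∃ m : ℤ, θ r = m * Real.pi := by
    rintro r ⟨hr, h0⟩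
    obtain ⟨hρ, hγ⟩ := hp.2 r (mem_Ici.2 hr.le)
    have h1 : opJ w r = ρ r * Real.sin (θ r) := congrArg Prod.snd hγ
    rw [h0] at h1
    have h2 : Real.sin (θ r) = 0 := by
      rcases mul_eq_zero.1 h1.symm with h | h
      · exact absurd h hρ.ne'
      · exact h
    obtain ⟨m, hm⟩ := Real.sin_eq_zero_iff.1 h2
    exact ⟨m, hm.symm⟩
  choose! m hm using hint
  -- By `angle_lt` each axis point has a new multiple of `π` as angle. Infinitely many integers
  -- bounded below are unbounded above, and `angle_lt` also prevents the angle from falling back.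
  have hinj : InjOn m {r | R < r ∧ opJ w r = 0} := by
    have key : ∀ r₁ r₂, R < r₁ → opJ w r₁ = 0 → R < r₂ → opJ w r₂ = 0 → m r₁ = m r₂ →
        ¬ r₁ < r₂ := by
      intro r₁ r₂ h1 hJ1 h2 hJ2 heq h12
      have h3 := hlt r₁ h1.le r₂ h2.le h12 (2 * m r₁) (by
        rw [hm r₁ ⟨h1, hJ1⟩]
        push_cast
        linarith)
      rw [hm r₂ ⟨h2, hJ2⟩, heq] at h3
      push_cast at h3
      linarith
    intro r₁ h1 r₂ h2 heq
    exact le_antisymm (not_lt.1 (key r₂ r₁ h2.1 h2.2 h1.1 h1.2 heq.symm))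
      (not_lt.1 (key r₁ r₂ h1.1 h1.2 h2.1 h2.2 heq))
  have himg := hinf.image hinj
  have hbelow : ∃ m₀ : ℤ, ∀ r, R < r → opJ w r = 0 → m₀ ≤ m r := by
    refine ⟨⌊θ R / Real.pi⌋, fun r hr hr0 => ?_⟩
    have h3 := hlt R (mem_Ici.2 le_rfl) r hr.le hr (2 * ⌊θ R / Real.pi⌋) (by
      have := (le_div_iff₀ Real.pi_pos).1 (Int.floor_le (θ R / Real.pi))
      push_cast
      linarith)
    rw [hm r ⟨hr, hr0⟩] at h3
    push_cast at h3
    have h4 : (⌊θ R / Real.pi⌋ : ℝ) * Real.pi < m r * Real.pi := by linarith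
    have h5 : (⌊θ R / Real.pi⌋ : ℝ) < m r := lt_of_mul_lt_mul_right h4 Real.pi_pos.le
    exact_mod_cast h5.le
  obtain ⟨m₀, hm₀⟩ := hbelow
  rw [tendsto_atTop]
  intro a
  obtain ⟨r, ⟨hr, hr0⟩, hra⟩ : ∃ r, (R < r ∧ opJ w r = 0) ∧ a ≤ m r * Real.pi := by
    by_contra hcon
    push Not at hcon
    refine himg ((Set.finite_Icc m₀ ⌈a / Real.pi⌉).subset ?_)
    rintro _ ⟨r, hr, rfl⟩
    refine ⟨hm₀ r hr.1 hr.2, ?_⟩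
    have h1 := (lt_div_iff₀ Real.pi_pos).2 (hcon r hr)
    have h2 : (m r : ℝ) < ⌈a / Real.pi⌉ := h1.trans_le (Int.le_ceil _)
    exact_mod_cast h2.le
  filter_upwards [eventually_gt_atTop r] with s hs
  have h3 := hlt r hr.le s (hr.trans hs).le hs (2 * m r) (by
    rw [hm r ⟨hr, hr0⟩]
    push_cast
    linarith)
  push_cast at h3
  linarith

end Orbit

/-! ### Convergence of orbits -/

namespace Orbit

variable {N : ℝ} {f : ℝ → ℝ} {b β α : ℝ} {w : ℝ → ℝ}

/-- While the orbit stays away from the origin, its energy descends to the minimum `F(b)`. -/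
theorem exists_energy_lt (O : Orbit N f b β α w) {δ r₀ : ℝ} (hδ : 0 < δ)
    (hw : ∀ r, r₀ ≤ r → δ ≤ w r) {η : ℝ} (hη : 0 < η) :
    ∃ r, 0 ≤ r ∧ energy f w r < primF f b + η := by
  by_contra hcon
  push Not at hcon
  have hN := O.two_lt
  obtain ⟨M, hM, hMb⟩ := O.exists_slope_bound
  set g : ℝ × ℝ → ℝ := fun p => p.2 ^ 2 + (p.1 - b) * f p.1 with hg
  -- If the energy never drops below `F(b) + η`, the points `(w, y)` stay in a compact set not
  -- containing `(b, 0)`, where `y² + (w - b) f(w)` has a positive minimum `c`.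
  set K : Set (ℝ × ℝ) := Icc δ |α| ×ˢ Icc (-M) M ∩
    {p | primF f b + η ≤ p.2 ^ 2 / 2 + primF f p.1} with hK
  have hKc : IsCompact K := by
    refine (isCompact_Icc.prod isCompact_Icc).inter_right (isClosed_le continuous_const ?_)
    exact ((continuous_snd.pow 2).div_const 2).add (O.shape.continuous_F.comp continuous_fst)
  have hmem : ∀ r, max r₀ 0 ≤ r → (w r, r * opJ w r) ∈ K := by
    intro r hr
    have h1 := le_trans (le_max_left _ _) hr
    have h2 := le_trans (le_max_right _ _) hr
    exact ⟨⟨⟨hw r h1, (le_abs_self _).trans (O.abs_le h2)⟩, _root_.abs_le.1 (hMb r h2)⟩,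
      hcon r h2⟩
  obtain ⟨p, hpK, hpmin⟩ := hKc.exists_isMinOn ⟨_, hmem _ le_rfl⟩
    (f := g) (((continuous_snd.pow 2).add ((continuous_fst.sub continuous_const).mul
      (O.shape.cont.comp continuous_fst))).continuousOn)
  have hc0 : 0 < g p := by
    obtain ⟨⟨hp1, -⟩, hp2⟩ := hpK
    have hp0 : 0 < p.1 := hδ.trans_le hp1.1
    rcases eq_or_ne p.1 b with h | h
    · have hp2 : primF f b + η ≤ p.2 ^ 2 / 2 + primF f p.1 := hp2
      simp only [hg]
      rw [h] at hp2 ⊢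
      rw [sub_self, zero_mul]
      linarith
    · have := O.shape.sub_mul_f_pos hp0 h
      simp only [hg]
      nlinarith [sq_nonneg p.2]
  set c := g p with hc
  set κ := (N - 1) / 2 with hκ
  have hκ0 : 0 < κ := by rw [hκ]; linarith
  set B := (|α| + b) * M with hB
  have hB0 : 0 ≤ B := mul_nonneg (add_nonneg (abs_nonneg _) O.shape.b_pos.le) hM.le
  have hprod : ∀ r, 0 ≤ r → |(w r - b) * (r * opJ w r)| ≤ B := by
    intro r hr
    rw [abs_mul]
    refine mul_le_mul ?_ (hMb r hr) (abs_nonneg _)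
      (add_nonneg (abs_nonneg _) O.shape.b_pos.le)
    refine (abs_sub _ _).trans ?_
    rw [abs_of_pos O.shape.b_pos]
    linarith [O.abs_le hr]
  -- The correction makes the dissipation see the position as well. The choice `κ = (N-1)/2` leaves
  -- `-κ/r` times `y² + (w - b) f(w)`, up to a term of order `1/r²`.
  set V : ℝ → ℝ := fun r => energy f w r - κ / r * ((w r - b) * (r * opJ w r)) with hV
  -- Beyond `2NB/c` the `1/r²` term is at most half of the main one.
  set r₁ := max (max r₀ 1) (2 * N * B / c) with hr₁
  have hr₁1 : 1 ≤ r₁ := (le_max_right _ _).trans (le_max_left _ _)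
  have hVd : ∀ r, 0 < r → HasDerivAt V
      (-(κ / r) * g (w r, r * opJ w r) + κ * N / r ^ 2 * ((w r - b) * (r * opJ w r))) r := by
    intro r hr
    have h1 : HasDerivAt (fun r : ℝ => κ / r) (-κ / r ^ 2) r := by
      refine ((hasDerivAt_const r κ).div (hasDerivAt_id r) hr.ne').congr_deriv ?_
      simp
    have h2 := (O.hasDerivAt_energy hr).sub
      (h1.mul (((O.hasDerivAt hr).sub_const b).mul (O.hasDerivAt_slope hr)))
    refine h2.congr_deriv ?_
    simp only [hg, hκ, Pi.mul_apply]
    field_simp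
    ring
  have hVle : ∀ r, r₁ ≤ r → -(κ / r) * g (w r, r * opJ w r) +
      κ * N / r ^ 2 * ((w r - b) * (r * opJ w r)) ≤ -(κ * c / 2) * r⁻¹ := by
    intro r hr
    have hr1 : 1 ≤ r := hr₁1.trans hr
    have hr0 : 0 < r := by linarith
    have h1 : c ≤ g (w r, r * opJ w r) := hpmin (hmem r (max_le
      (((le_max_left _ _).trans (le_max_left _ _)).trans hr) hr0.le))
    have h2 : 2 * N * B ≤ r * c := (div_le_iff₀ hc0).1 ((le_max_right _ _).trans hr)
    have h3 := (_root_.abs_le.1 (hprod r hr0.le)).2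
    have h4 : κ / r * c ≤ κ / r * g (w r, r * opJ w r) :=
      mul_le_mul_of_nonneg_left h1 (by positivity)
    have h5 : κ * N / r ^ 2 * ((w r - b) * (r * opJ w r)) ≤ κ * N / r ^ 2 * B :=
      mul_le_mul_of_nonneg_left h3 (by positivity)
    have h6 : κ * N / r ^ 2 * B ≤ κ / r * (c / 2) := by
      have h7 : κ * N / r ^ 2 * B = κ / r ^ 2 * (2 * N * B) / 2 := by ring
      have h8 : κ / r * (c / 2) = κ / r ^ 2 * (r * c) / 2 := by field_simp
      rw [h7, h8]
      have : κ / r ^ 2 * (2 * N * B) ≤ κ / r ^ 2 * (r * c) :=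
        mul_le_mul_of_nonneg_left h2 (by positivity)
      linarith
    have h9 : -(κ * c / 2) * r⁻¹ = -(κ / r * c) + κ / r * (c / 2) := by
      field_simp
      ring
    rw [h9]
    linarith
  have hanti : AntitoneOn (fun r => V r + κ * c / 2 * Real.log r) (Ici r₁) := by
    have hd : ∀ r ∈ Ici r₁, HasDerivAt (fun r => V r + κ * c / 2 * Real.log r)
        ((-(κ / r) * g (w r, r * opJ w r) + κ * N / r ^ 2 * ((w r - b) * (r * opJ w r))) +
          κ * c / 2 * r⁻¹) r := by
      intro r hr
      have hr0 : 0 < r := by linarith [mem_Ici.1 hr]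
      exact (hVd r hr0).add ((Real.hasDerivAt_log hr0.ne').const_mul _)
    refine antitoneOn_of_deriv_nonpos (convex_Ici _)
      (fun r hr => (hd r hr).continuousAt.continuousWithinAt) ?_ ?_
    · rw [interior_Ici]
      exact fun r hr => (hd r (mem_Ici.2 (le_of_lt hr))).differentiableAt.differentiableWithinAt
    · rw [interior_Ici]
      intro r hr
      rw [(hd r (mem_Ici.2 (le_of_lt hr))).deriv]
      have := hVle r (le_of_lt (mem_Ioi.1 hr))
      linarith
  have hVlow : ∀ r, r₁ ≤ r → primF f b - κ * B ≤ V r := by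
    intro r hr
    have hr1 : 1 ≤ r := hr₁1.trans hr
    have hr0 : 0 < r := by linarith
    have h1 := O.F_b_le_energy r
    have h3 := (_root_.abs_le.1 (hprod r hr0.le)).2
    have h4 : κ / r * ((w r - b) * (r * opJ w r)) ≤ κ / r * B :=
      mul_le_mul_of_nonneg_left h3 (by positivity)
    have h5 : κ / r * B ≤ κ * B :=
      mul_le_mul_of_nonneg_right (div_le_self hκ0.le hr1) hB0
    simp only [hV]
    linarith
  have hlog : Tendsto (fun r => κ * c / 2 * Real.log r) atTop atTop :=
    Real.tendsto_log_atTop.const_mul_atTop (by positivity)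
  obtain ⟨r, hr1, hr2⟩ := ((eventually_ge_atTop r₁).and
    (hlog.eventually_gt_atTop (V r₁ + κ * c / 2 * Real.log r₁ - (primF f b - κ * B)))).exists
  have h1 := hanti (mem_Ici.2 le_rfl) hr1 hr1
  have h2 := hVlow r hr1
  simp only at h1
  linarith

/-- An orbit staying away from the vertical axis converges to the equilibrium `b`. -/
theorem tendsto_curveJ (O : Orbit N f b β α w) {δ r₀ : ℝ} (hδ : 0 < δ)
    (hw : ∀ r, r₀ ≤ r → δ ≤ w r) : Tendsto (curveJ w) atTop (𝓝 (b, 0)) := by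
  have hE : ∀ η > 0, ∀ᶠ r in atTop, energy f w r < primF f b + η := by
    intro η hη
    obtain ⟨r, hr, h⟩ := O.exists_energy_lt hδ hw hη
    filter_upwards [eventually_ge_atTop r] with s hs
    exact (O.antitoneOn_energy hr (hr.trans hs) hs).trans_lt h
  refine Tendsto.prodMk_nhds ?_ ?_
  · rw [Metric.tendsto_atTop']
    intro ε hε
    -- Keeping `b - ε'` positive places it on the decreasing branch of `F`, so the energy bound
    -- confines `w` from both sides.
    set ε' := min ε b / 2 with hε'
    have hb := O.shape.b_pos
    have hε'0 : 0 < ε' := half_pos (lt_min hε hb)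
    have hε'b : ε' < b := by
      have := min_le_right ε b
      rw [hε']
      linarith
    have hε'ε : ε' < ε := by
      have := min_le_left ε b
      rw [hε']
      linarith
    have h1 : primF f b < primF f (b - ε') := by
      refine O.shape.F_b_lt ?_
      rw [abs_of_pos (by linarith)]
      linarith
    have h2 : primF f b < primF f (b + ε') := by
      refine O.shape.F_b_lt ?_
      rw [abs_of_pos (by linarith)]
      linarith
    have h3 := hE (min (primF f (b - ε')) (primF f (b + ε')) - primF f b)
      (by rw [gt_iff_lt, sub_pos]; exact lt_min h1 h2)
    obtain ⟨r₂, hr₂⟩ := eventually_atTop.1 (h3.and (eventually_ge_atTop r₀))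
    refine ⟨r₂, fun r hr => ?_⟩
    obtain ⟨h4, h5⟩ := hr₂ r hr.le
    have h6 : primF f (w r) < min (primF f (b - ε')) (primF f (b + ε')) := by
      have := F_le_energy (f := f) (w := w) r
      linarith
    have hw0 : 0 < w r := hδ.trans_le (hw r h5)
    rw [Real.dist_eq]
    refine lt_of_le_of_lt ?_ hε'ε
    rw [_root_.abs_le]
    constructor
    · by_contra hlt
      have hlt' : w r < b - ε' := by linarith
      have h7 := O.shape.F_strictAntiOn ⟨hw0.le, by linarith⟩ ⟨by linarith, by linarith⟩ hlt'
      exact absurd (h6.trans_le (min_le_left _ _)) h7.not_gt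
    · by_contra hlt
      have hlt' : b + ε' < w r := by linarith
      have h7 := O.shape.F_strictMonoOn (mem_Ici.2 (by linarith)) (mem_Ici.2 (by linarith)) hlt'
      exact absurd (h6.trans_le (min_le_right _ _)) h7.not_gt
  · rw [Metric.tendsto_atTop']
    intro ε hε
    obtain ⟨r₂, hr₂⟩ := eventually_atTop.1 ((hE (ε ^ 2 / 2) (by positivity)).and
      (eventually_ge_atTop 1))
    refine ⟨r₂, fun r hr => ?_⟩
    obtain ⟨h4, h5⟩ := hr₂ r hr.le
    have h6 := O.shape.F_b_le (w r)
    unfold energy at h4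
    have h7 := abs_lt_of_sq_lt_sq (show (r * opJ w r) ^ 2 < ε ^ 2 by linarith) hε.le
    rw [dist_zero_right, Real.norm_eq_abs]
    rw [abs_mul, abs_of_pos (by linarith : 0 < r)] at h7
    exact (le_mul_of_one_le_left (abs_nonneg _) h5).trans_lt h7

/-- The derivative of a convergent orbit tends to zero. -/
theorem tendsto_slope_zero (O : Orbit N f b β α w) {L : ℝ} (hw : Tendsto w atTop (𝓝 L)) :
    Tendsto (fun r => r * opJ w r) atTop (𝓝 0) := by
  have hE : ∃ l, Tendsto (energy f w) atTop (𝓝 l) := by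
    have hanti : Antitone fun r => energy f w (max r 0) := fun r s hrs =>
      O.antitoneOn_energy (mem_Ici.2 (le_max_right _ _)) (mem_Ici.2 (le_max_right _ _))
        (max_le_max_right 0 hrs)
    have hb : BddBelow (range fun r => energy f w (max r 0)) := by
      refine ⟨primF f b, ?_⟩
      rintro _ ⟨r, rfl⟩
      exact O.F_b_le_energy _
    refine ⟨_, (tendsto_atTop_ciInf hanti hb).congr' ?_⟩
    filter_upwards [eventually_ge_atTop 0] with r hr
    rw [max_eq_left hr]
  obtain ⟨l, hl⟩ := hE
  have hv : Tendsto (fun r => (r * opJ w r) ^ 2) atTop (𝓝 (2 * (l - primF f L))) := by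
    have h1 := (hl.sub ((O.shape.continuous_F.tendsto L).comp hw)).const_mul 2
    refine h1.congr fun r => ?_
    simp only [energy, Function.comp]
    ring
  -- The energy converges, hence so does `y²`. A positive limit would make `w` move by a fixed
  -- amount over unit intervals far out, by the mean value theorem.
  set q := 2 * (l - primF f L) with hq
  have hq0 : 0 ≤ q := ge_of_tendsto' hv fun r => sq_nonneg _
  rcases hq0.eq_or_lt with h | h
  · rw [← h] at hv
    have h2 := (Real.continuous_sqrt.tendsto 0).comp hv
    rw [Real.sqrt_zero] at h2
    rw [tendsto_zero_iff_abs_tendsto_zero]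
    refine h2.congr fun r => ?_
    simp only [Function.comp, Real.sqrt_sq_eq_abs]
  · exfalso
    have h1 : Tendsto (fun r => w (r + 1) - w r) atTop (𝓝 0) := by
      have := (hw.comp (tendsto_atTop_add_const_right atTop (1 : ℝ) tendsto_id)).sub hw
      simpa using this
    have h2 : Tendsto (fun r => (w (r + 1) - w r) ^ 2) atTop (𝓝 0) := by simpa using h1.pow 2
    obtain ⟨r₁, hr₁⟩ := eventually_atTop.1
      ((hv.eventually (lt_mem_nhds (half_lt_self h))).and (eventually_gt_atTop 0))
    obtain ⟨r, hr, hr'⟩ :=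
      ((h2.eventually (gt_mem_nhds (half_pos h))).and (eventually_ge_atTop r₁)).exists
    have hr0 : 0 < r := (hr₁ r hr').2
    obtain ⟨x, hx, hxe⟩ := exists_deriv_eq_slope w (show r < r + 1 by linarith)
      (O.continuousOn.mono fun y hy => mem_Ici.2 (by linarith [hy.1]))
      (fun y hy => (O.sol.diff y (by linarith [hy.1])).differentiableWithinAt)
    have h3 := (hr₁ x (hr'.trans hx.1.le)).1
    rw [deriv_eq_opJ w (by linarith [hx.1])] at hxe
    have h4 : w (r + 1) - w r = -(x * opJ w x) := by
      rw [hxe]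
      ring
    rw [h4] at hr
    have : (-(x * opJ w x)) ^ 2 = (x * opJ w x) ^ 2 := by ring
    linarith

theorem tendsto_curveJ_of_tendsto (O : Orbit N f b β α w) {L : ℝ} (hw : Tendsto w atTop (𝓝 L)) :
    Tendsto (curveJ w) atTop (𝓝 (L, 0)) := by
  refine Tendsto.prodMk_nhds hw ?_
  have := (O.tendsto_slope_zero hw).mul tendsto_inv_atTop_zero
  rw [zero_mul] at this
  refine this.congr' ?_
  filter_upwards [eventually_gt_atTop 0] with r hr
  field_simp

end Orbit

/-! ### Finitely many crossings -/

/-- A positive sequence `e` cannot lose `c / T` at each of infinitely many times `T → ∞` whose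
gaps are at most `C / √e`. -/
theorem not_forall_slow_descent {T e : ℕ → ℝ} {c C : ℝ} (hc : 0 < c) (hC : 0 < C)
    (hT0 : ∀ i, 0 < T i) (hT : Monotone T) (hTtop : Tendsto T atTop atTop) (he : ∀ i, 0 < e i)
    (h1 : ∀ i, c / T i ≤ e i - e (i + 1)) (h2 : ∀ i, T (i + 1) - T i ≤ C / √(e (i + 1))) :
    False := by
  set a : ℕ → ℝ := fun i => √(e (i + 1)) with ha
  set κ := c / (2 * C) with hκ
  have hκ0 : 0 < κ := by positivity
  -- A drop `c/T` of `a²` costs at least `c/(2aT)` in `a`, and the gap bound gives `1/a ≥ (T_{i+1} -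
  -- T_i)/C`.
  have hstep : ∀ i, κ * ((T (i + 1) - T i) / T (i + 1)) ≤ a i - a (i + 1) := by
    intro i
    have hx : 0 < a i := Real.sqrt_pos.2 (he _)
    have hy : 0 < a (i + 1) := Real.sqrt_pos.2 (he _)
    have hx2 : a i ^ 2 = e (i + 1) := Real.sq_sqrt (he _).le
    have hy2 : a (i + 1) ^ 2 = e (i + 1 + 1) := Real.sq_sqrt (he _).le
    have h3 := h1 (i + 1)
    have h4 : (T (i + 1) - T i) * a i ≤ C := (le_div_iff₀ hx).1 (h2 i)
    have hTi := hT0 (i + 1)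
    have hcT : 0 < c / T (i + 1) := div_pos hc hTi
    have hlt : a (i + 1) < a i := by nlinarith
    have h5 : c / T (i + 1) ≤ (a i - a (i + 1)) * (2 * a i) := by nlinarith
    have h6 : κ * ((T (i + 1) - T i) / T (i + 1)) * (2 * a i) ≤ c / T (i + 1) := by
      have : κ * ((T (i + 1) - T i) / T (i + 1)) * (2 * a i) =
          c / T (i + 1) * ((T (i + 1) - T i) * a i / C) := by
        rw [hκ]
        field_simp
      rw [this]
      exact mul_le_of_le_one_right hcT.le ((div_le_one hC).2 h4)
    exact le_of_mul_le_mul_right (h6.trans h5) (by positivity)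
  -- Each denominator is replaced by the largest one, `T n`, so the sum telescopes. Once `T n ≥ 2 T
  -- m` the drop is at least `κ/2`, which a convergent sequence does not allow from late `m`.
  have hsum : ∀ m n, m ≤ n → κ * ((T n - T m) / T n) ≤ a m - a n := by
    intro m n hmn
    induction n, hmn using Nat.le_induction with
    | base => simp
    | succ n hmn ih =>
      have h3 := hstep n
      have hTn := hT0 n
      have hTn1 := hT0 (n + 1)
      have h4 : (T n - T m) / T (n + 1) ≤ (T n - T m) / T n :=
        div_le_div_of_nonneg_left (sub_nonneg.2 (hT hmn)) hTn (hT n.le_succ)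
      have h5 : (T (n + 1) - T m) / T (n + 1) =
          (T n - T m) / T (n + 1) + (T (n + 1) - T n) / T (n + 1) := by ring
      rw [h5, mul_add]
      have := mul_le_mul_of_nonneg_left h4 hκ0.le
      linarith
  have hanti : Antitone a := by
    refine antitone_nat_of_succ_le fun i => ?_
    have h3 := hstep i
    have : 0 ≤ κ * ((T (i + 1) - T i) / T (i + 1)) :=
      mul_nonneg hκ0.le (div_nonneg (sub_nonneg.2 (hT i.le_succ)) (hT0 _).le)
    linarith
  have hb : BddBelow (range a) := ⟨0, by rintro _ ⟨i, rfl⟩; exact Real.sqrt_nonneg _⟩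
  have hlim := tendsto_atTop_ciInf hanti hb
  obtain ⟨m, hm⟩ := (hlim.eventually (gt_mem_nhds (lt_add_of_pos_right _ (half_pos hκ0)))).exists
  obtain ⟨n, hmn, hn⟩ := ((eventually_ge_atTop m).and
    (hTtop.eventually_ge_atTop (2 * T m))).exists
  have h3 := hsum m n hmn
  have h4 : (1 : ℝ) / 2 ≤ (T n - T m) / T n := by
    rw [div_le_div_iff₀ two_pos (hT0 n)]
    linarith
  have h5 := mul_le_mul_of_nonneg_left h4 hκ0.le
  have h6 := ciInf_le hb n
  linarith

namespace Orbit

variable {N : ℝ} {f : ℝ → ℝ} {b β α : ℝ} {w : ℝ → ℝ}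

/-- The midpoint of `b` and `β` leaves a buffer: turning points at height at least `β` stay above it
for a fixed time, during which the force is bounded below. -/
theorem exists_f_bound (O : Orbit N f b β α w) :
    ∃ m, 0 < m ∧ ∀ s, (b + β) / 2 ≤ s → s ≤ |α| → m ≤ f s := by
  have hb := O.shape.b_lt
  obtain ⟨p, hp, hmin⟩ := (isCompact_Icc (a := (b + β) / 2) (b := |α|)).exists_isMinOn
    ⟨|α|, by linarith [O.le_abs], le_rfl⟩ O.shape.cont.continuousOn
  exact ⟨f p, O.shape.pos p (by linarith [hp.1]), fun s h1 h2 => hmin ⟨h1, h2⟩⟩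

/-- Far out, friction is at most half of the least force `m`. -/
theorem opJ_term_le (O : Orbit N f b β α w) {m M r : ℝ} (hm : 0 < m)
    (hM : |r * opJ w r| ≤ M) (hr0 : 0 < r) (hr : 2 * (N - 1) * M / m ≤ r) :
    |(N - 1) * opJ w r| ≤ m / 2 := by
  have hN := O.two_lt
  rw [abs_mul, abs_of_pos hr0] at hM
  have h1 := (div_le_iff₀ hm).1 hr
  rw [abs_mul, abs_of_pos (by linarith : 0 < N - 1)]
  have h2 : (N - 1) * (r * |opJ w r|) ≤ (N - 1) * M := mul_le_mul_of_nonneg_left hM (by linarith)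
  refine le_of_mul_le_mul_left ?_ hr0
  linarith

/-- The energy lost after leaving a turning point. -/
theorem energy_loss (O : Orbit N f b β α w) {m M t₀ T T' : ℝ} (hm : 0 < m) (hM0 : 0 < M)
    (hmf : ∀ s, (b + β) / 2 ≤ s → s ≤ |α| → m ≤ f s) (hM : ∀ r, 0 ≤ r → |r * opJ w r| ≤ M)
    (ht₀ : t₀ = (β - (b + β) / 2) / M) (hT1 : 2 * (N - 1) * M / m ≤ T) (hT2 : t₀ ≤ T)
    (hTT' : T < T') (hJ : opJ w T = 0) (hwT : w T ≤ -β) (hwT' : β ≤ w T') :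
    T + t₀ ≤ T' ∧
      (N - 1) * (m * t₀ / 4) ^ 2 * t₀ / 4 / T ≤ energy f w T - energy f w T' := by
  have hN := O.two_lt
  have hb := O.shape.b_lt
  have hb0 := O.shape.b_pos
  have ht0 : 0 < t₀ := by
    rw [ht₀]
    exact div_pos (by linarith) hM0
  have hT0 : 0 < T := ht0.trans_le hT2
  have hMt : M * t₀ = β - (b + β) / 2 := by
    rw [ht₀]
    field_simp
  have hw : ∀ r, T ≤ r → r ≤ T + t₀ → w r ≤ -((b + β) / 2) := by
    intro r h1 h2
    have h3 := sub_le_of_hasDerivAt_le h1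
      (O.continuousOn.mono fun x hx => mem_Ici.2 (hT0.le.trans hx.1))
      (fun x hx => O.hasDerivAt (hT0.trans hx.1))
      (fun x hx => (neg_le_abs _).trans (hM x (hT0.trans hx.1).le))
    have h4 : M * (r - T) ≤ M * t₀ := mul_le_mul_of_nonneg_left (by linarith) hM0.le
    linarith
  have hle : T + t₀ ≤ T' := by
    by_contra hlt
    have := hw T' hTT'.le (by linarith)
    linarith
  refine ⟨hle, ?_⟩
  -- During the time `t₀`, in which speed at most `M` cannot cross the buffer, force minus friction
  -- builds up speed at rate at least `m/2`.
  have hy : ∀ r, T ≤ r → r ≤ T + t₀ → r * opJ w r ≤ -(m / 2) * (r - T) := by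
    intro r h1 h2
    have h3 := sub_le_of_hasDerivAt_le (C := -(m / 2)) h1
      ((continuousOn_id.mul O.continuousOn_opJ).mono
        fun x hx => mem_Ici.2 (hT0.le.trans hx.1))
      (fun x hx => O.hasDerivAt_slope (hT0.trans hx.1)) (fun x hx => by
        have hx0 : 0 < x := hT0.trans hx.1
        have h4 := hw x hx.1.le (hx.2.le.trans h2)
        have h5 := hmf (-w x) (by linarith) ((neg_le_abs _).trans (O.abs_le hx0.le))
        rw [O.shape.odd] at h5
        have h6 := (_root_.abs_le.1 (O.opJ_term_le hm (hM x hx0.le) hx0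
          (hT1.trans hx.1.le))).1
        linarith)
    simp only [Pi.mul_apply, id, hJ, mul_zero, sub_zero] at h3
    exact h3
  -- On the second half of this time the speed is at least `m t₀/4`, while `r ≤ T + t₀ ≤ 2T`.
  have hE := sub_le_of_hasDerivAt_le (g := energy f w) (a := T + t₀ / 2) (c := T + t₀)
    (C := -((N - 1) * (m * t₀ / 4) ^ 2 / (2 * T))) (by linarith)
    (O.continuousOn_energy.mono fun x hx => mem_Ici.2 (by linarith [hx.1]))
    (fun x hx => O.hasDerivAt_energy (by linarith [hx.1])) (fun x hx => by
      have hx0 : 0 < x := by linarith [hx.1]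
      have h4 := hy x (by linarith [hx.1]) hx.2.le
      have h4' : x * opJ w x ≤ -(m * t₀ / 4) := by
        have : m / 2 * (t₀ / 2) ≤ m / 2 * (x - T) :=
          mul_le_mul_of_nonneg_left (by linarith [hx.1]) (by linarith)
        linarith
      have h5 : (m * t₀ / 4) ^ 2 ≤ (x * opJ w x) ^ 2 := by
        have : 0 < m * t₀ / 4 := by positivity
        nlinarith
      have h6 : (N - 1) * x * opJ w x ^ 2 = (N - 1) * (x * opJ w x) ^ 2 / x := by
        field_simp
      rw [h6, neg_le_neg_iff]
      refine div_le_div₀ (mul_nonneg (by linarith) (sq_nonneg _))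
        (mul_le_mul_of_nonneg_left h5 (by linarith)) hx0 (by linarith [hx.2]))
  have h7 := O.antitoneOn_energy (mem_Ici.2 hT0.le) (mem_Ici.2 (by linarith))
    (show T ≤ T + t₀ / 2 by linarith)
  have h8 := O.antitoneOn_energy (mem_Ici.2 (by linarith)) (mem_Ici.2 (by linarith)) hle
  have h9 : (N - 1) * (m * t₀ / 4) ^ 2 * t₀ / 4 / T =
      (N - 1) * (m * t₀ / 4) ^ 2 / (2 * T) * (T + t₀ - (T + t₀ / 2)) := by
    field_simp
    ring
  rw [h9]
  linarith

/-- The time between consecutive turning points. -/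
theorem turning_time_le (O : Orbit N f b β α w) {m M T T' : ℝ} (hm : 0 < m) (hM0 : 0 < M)
    (hmf : ∀ s, (b + β) / 2 ≤ s → s ≤ |α| → m ≤ f s) (hM : ∀ r, 0 ≤ r → |r * opJ w r| ≤ M)
    (hT1 : 2 * (N - 1) * M / m ≤ T) (hT0 : 0 < T)
    (hTT' : T < T') (hJ : opJ w T = 0) (hJ' : opJ w T' = 0) (hwT : w T ≤ -β) (hwT' : β ≤ w T')
    (hmono : ∀ s ∈ Ioo T T', opJ w s < 0) (he : 0 < energy f w T') :
    T' - T ≤ (3 * M / m * √(primF f α) + 2 * β) / √(energy f w T') := by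
  have hN := O.two_lt
  have hb := O.shape.b_lt
  have hb0 := O.shape.b_pos
  have hcont : ContinuousOn w (Icc T T') :=
    O.continuousOn.mono fun x hx => mem_Ici.2 (hT0.le.trans hx.1)
  have hyc : ContinuousOn (fun r => r * opJ w r) (Ici 0) := continuousOn_id.mul O.continuousOn_opJ
  have hw : StrictMonoOn w (Icc T T') := by
    refine strictMonoOn_of_deriv_pos (convex_Icc _ _) hcont fun x hx => ?_
    rw [interior_Icc] at hx
    have hx0 : 0 < x := hT0.trans hx.1
    rw [deriv_eq_opJ w hx0]
    have := mul_neg_of_pos_of_neg hx0 (hmono x hx)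
    linarith
  obtain ⟨p, hp, hwp⟩ : -β ∈ w '' Icc T T' :=
    intermediate_value_Icc hTT'.le hcont ⟨hwT, by linarith⟩
  obtain ⟨q, hq, hwq⟩ : β ∈ w '' Icc T T' :=
    intermediate_value_Icc hTT'.le hcont ⟨by linarith, hwT'⟩
  have hpq : p < q := (hw.lt_iff_lt hp hq).1 (by rw [hwp, hwq]; linarith)
  -- Three stretches are timed: below `-β` the speed grows at rate at least `m/2` up to at most `M`;
  -- above `β` it decays at rate at least `m`, friction now helping; in between, where `F ≤ 0`, it
  -- is at least `√e`.
  have h1 : p - T ≤ 2 * M / m := by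
    have h3 := sub_le_of_hasDerivAt_le (C := -(m / 2)) hp.1
      (hyc.mono fun x hx => mem_Ici.2 (hT0.le.trans hx.1))
      (fun x hx => O.hasDerivAt_slope (hT0.trans hx.1)) (fun x hx => by
        have hx0 : 0 < x := hT0.trans hx.1
        have h4 := hw.monotoneOn ⟨hx.1.le, hx.2.le.trans hp.2⟩ hp hx.2.le
        have h5 := hmf (-w x) (by linarith) ((neg_le_abs _).trans (O.abs_le hx0.le))
        rw [O.shape.odd] at h5
        have h6 := (_root_.abs_le.1 (O.opJ_term_le hm (hM x hx0.le) hx0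
          (hT1.trans hx.1.le))).1
        linarith)
    simp only [hJ, mul_zero, sub_zero] at h3
    have h4 := (_root_.abs_le.1 (hM p (hT0.le.trans hp.1))).1
    rw [le_div_iff₀ hm]
    linarith
  have h2 : T' - q ≤ M / m := by
    have h3 := le_sub_of_le_hasDerivAt (C := m) hq.2
      (hyc.mono fun x hx => mem_Ici.2 (hT0.le.trans (hq.1.trans hx.1)))
      (fun x hx => O.hasDerivAt_slope (hT0.trans_le (hq.1.trans hx.1.le))) (fun x hx => by
        have hx0 : 0 < x := hT0.trans_le (hq.1.trans hx.1.le)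
        have h4 := hw.monotoneOn hq ⟨hq.1.trans hx.1.le, hx.2.le⟩ hx.1.le
        have h5 := hmf (w x) (by linarith) ((le_abs_self _).trans (O.abs_le hx0.le))
        have h6 := hmono x ⟨hq.1.trans_lt hx.1, hx.2⟩
        have h7 : (N - 1) * opJ w x ≤ 0 :=
          mul_nonpos_of_nonneg_of_nonpos (by linarith) h6.le
        linarith)
    simp only [hJ', mul_zero, zero_sub] at h3
    have h4 := (_root_.abs_le.1 (hM q (hT0.le.trans hq.1))).1
    rw [le_div_iff₀ hm]
    linarith
  set e := energy f w T' with hedef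
  have hse : 0 < √e := Real.sqrt_pos.2 he
  have h3 : q - p ≤ 2 * β / √e := by
    have h3 := le_sub_of_le_hasDerivAt (C := √e) hpq.le
      (hcont.mono (Icc_subset_Icc hp.1 hq.2))
      (fun x hx => O.hasDerivAt (hT0.trans_le (hp.1.trans hx.1.le))) (fun x hx => by
        have hxI : x ∈ Ioo T T' := ⟨hp.1.trans_lt hx.1, hx.2.trans_le hq.2⟩
        have hx0 : 0 < x := hT0.trans hxI.1
        have h4 := hw.monotoneOn hp (Ioo_subset_Icc_self hxI) hx.1.le
        have h5 := hw.monotoneOn (Ioo_subset_Icc_self hxI) hq hx.2.le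
        have h6 := O.shape.F_le_zero (s := w x) (_root_.abs_le.2 ⟨by linarith, by linarith⟩)
        have h7 := O.antitoneOn_energy (mem_Ici.2 hx0.le) (mem_Ici.2 (hT0.trans hTT').le) hxI.2.le
        have h8 : e ≤ (-(x * opJ w x)) ^ 2 := by
          have h9 : energy f w x = (x * opJ w x) ^ 2 / 2 + primF f (w x) := rfl
          nlinarith [sq_nonneg (x * opJ w x)]
        have h10 := mul_neg_of_pos_of_neg hx0 (hmono x hxI)
        exact (Real.sqrt_le_left (by linarith)).2 h8)
    rw [hwp, hwq] at h3
    rw [le_div_iff₀ hse]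
    linarith
  -- Since `e ≤ F(α)`, the bounded outer times also fit the form `C/√e`.
  have h4 : 3 * M / m ≤ 3 * M / m * √(primF f α) / √e := by
    rw [le_div_iff₀ hse]
    exact mul_le_mul_of_nonneg_left
      (Real.sqrt_le_sqrt (O.energy_le_init (hT0.trans hTT').le)) (by positivity)
  rw [add_div]
  have h5 : 3 * M / m = 2 * M / m + M / m := by ring
  linarith

/-- There is no infinite sequence of consecutive turning points on alternating sides. -/
theorem not_forall_turning (O : Orbit N f b β α w) {T : ℕ → ℝ} (hT0 : ∀ i, 0 < T i)
    (hT : ∀ i, T i < T (i + 1)) (hJ : ∀ i, opJ w (T i) = 0)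
    (hw : ∀ i : ℕ, β ≤ (-1) ^ i * w (T i))
    (hmono : ∀ i : ℕ, ∀ s ∈ Ioo (T i) (T (i + 1)), (-1) ^ (i + 1) * opJ w s < 0)
    (he : ∀ i, 0 < energy f w (T i)) : False := by
  have hN := O.two_lt
  obtain ⟨m, hm, hmf⟩ := O.exists_f_bound
  obtain ⟨M, hM0, hM⟩ := O.exists_slope_bound
  have hb := O.shape.b_lt
  have hb0 := O.shape.b_pos
  set t₀ := (β - (b + β) / 2) / M with ht₀
  have ht0 : 0 < t₀ := div_pos (by linarith) hM0
  have hσ : ∀ i : ℕ, (-1 : ℝ) ^ i = 1 ∨ (-1 : ℝ) ^ i = -1 := neg_one_pow_eq_or ℝ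
  -- Crossing from one side of `(-β, β)` to the other at speed at most `M` takes a minimal time,
  -- whence `T i → ∞`.
  have hTle : ∀ i, T (i + 1) - T i ≥ β / M := by
    intro i
    have h3 := fun σ : ℝ => sub_le_of_hasDerivAt_le (g := fun r => σ * w r) (C := |σ| * M)
      (hT i).le
      (continuousOn_const.mul (O.continuousOn.mono fun x hx =>
        mem_Ici.2 ((hT0 i).le.trans hx.1)))
      (fun x hx => (O.hasDerivAt ((hT0 i).trans hx.1)).const_mul σ) (fun x hx => by
        refine (le_abs_self _).trans ?_
        rw [abs_mul, abs_neg]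
        exact mul_le_mul_of_nonneg_left (hM x ((hT0 i).trans hx.1).le) (abs_nonneg _))
    have h4 := h3 ((-1) ^ (i + 1))
    have h5 := hw i
    have h6 := hw (i + 1)
    have h7 : |(-1 : ℝ) ^ (i + 1)| = 1 := by simp
    have h8 : (-1 : ℝ) ^ (i + 1) * w (T i) = -((-1) ^ i * w (T i)) := by ring
    rw [h7, one_mul, h8] at h4
    rw [ge_iff_le, div_le_iff₀ hM0]
    linarith
  have hlow : ∀ i : ℕ, (i : ℝ) * (β / M) ≤ T i := by
    intro i
    induction i with
    | zero => simpa using (hT0 0).le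
    | succ i ih =>
      have := hTle i
      push_cast
      linarith
  have htop : Tendsto T atTop atTop :=
    tendsto_atTop_mono hlow (tendsto_natCast_atTop_atTop.atTop_mul_const
      (div_pos (by linarith) hM0))
  obtain ⟨n, hn⟩ := eventually_atTop.1
    (htop.eventually_ge_atTop (max (2 * (N - 1) * M / m) t₀))
  have hmonoT : Monotone T := monotone_nat_of_le_succ fun i => (hT i).le
  have key : ∀ i, n ≤ i → (N - 1) * (m * t₀ / 4) ^ 2 * t₀ / 4 / T i ≤
      energy f w (T i) - energy f w (T (i + 1)) ∧
      T (i + 1) - T i ≤ (3 * M / m * √(primF f α) + 2 * β) / √(energy f w (T (i + 1))) := by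
    intro i hi
    -- This reflection makes the swing go upwards, from below `-β` to above `β`.
    set σ : ℝ := (-1) ^ (i + 1) with hσdef
    have hσi : σ = 1 ∨ σ = -1 := hσ (i + 1)
    have O' := O.const_mul hσi
    have hJ' : ∀ r, 0 ≤ r → opJ (fun r => σ * w r) r = σ * opJ w r :=
      fun r hr => O.opJ_const_mul O' hσi hr
    have hσ2 : σ ^ 2 = 1 := by rcases hσi with h | h <;> rw [h] <;> norm_num
    have hσF : ∀ s, primF f (σ * s) = primF f s := by
      intro s
      rcases hσi with h | h <;> rw [h]
      · rw [one_mul]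
      · rw [neg_one_mul, O.shape.F_neg]
    have habs : |σ * α| = |α| := by
      rcases hσi with h | h <;> rw [h] <;> simp
    have hM' : ∀ r, 0 ≤ r → |r * opJ (fun r => σ * w r) r| ≤ M := by
      intro r hr
      rw [hJ' r hr]
      have h9 := hM r hr
      rcases hσi with h | h <;> rw [h]
      · rwa [one_mul]
      · rwa [neg_one_mul, mul_neg, abs_neg]
    have hE' : ∀ r, 0 ≤ r → energy f (fun r => σ * w r) r = energy f w r := by
      intro r hr
      unfold energy
      rw [hJ' r hr, hσF]
      have : (r * (σ * opJ w r)) ^ 2 = σ ^ 2 * (r * opJ w r) ^ 2 := by ring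
      rw [this, hσ2, one_mul]
    have hi0 := (hT0 i).le
    have hi1 := (hT0 (i + 1)).le
    have hwi : σ * w (T i) ≤ -β := by
      have h5 := hw i
      have h8 : σ * w (T i) = -((-1) ^ i * w (T i)) := by
        rw [hσdef]
        ring
      linarith
    have hmf' : ∀ s, (b + β) / 2 ≤ s → s ≤ |σ * α| → m ≤ f s := by rwa [habs]
    have hr1 := (le_max_left _ _).trans (hn i hi)
    have hr2 := (le_max_right _ _).trans (hn i hi)
    have hJi : opJ (fun r => σ * w r) (T i) = 0 := by rw [hJ' _ hi0, hJ, mul_zero]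
    have hJi1 : opJ (fun r => σ * w r) (T (i + 1)) = 0 := by rw [hJ' _ hi1, hJ, mul_zero]
    have hloss := (O'.energy_loss hm hM0 hmf' hM' ht₀ hr1 hr2 (hT i) hJi hwi (hw (i + 1))).2
    have htime := O'.turning_time_le hm hM0 hmf' hM' hr1 (hT0 i) (hT i) hJi hJi1 hwi
      (hw (i + 1)) (fun s hs => by
        rw [hJ' s (hi0.trans hs.1.le)]
        exact hmono i s hs) (by rw [hE' _ hi1]; exact he _)
    rw [hE' _ hi0, hE' _ hi1] at hloss
    rw [hE' _ hi1, hσF] at htime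
    exact ⟨hloss, htime⟩
  refine not_forall_slow_descent (T := fun i => T (i + n)) (e := fun i => energy f w (T (i + n)))
    (c := (N - 1) * (m * t₀ / 4) ^ 2 * t₀ / 4) (C := 3 * M / m * √(primF f α) + 2 * β)
    ?_ ?_ (fun i => hT0 _) (fun i j hij => hmonoT (by omega))
    (htop.comp (tendsto_add_atTop_nat n)) (fun i => he _) (fun i => ?_) (fun i => ?_)
  · have : 0 < N - 1 := by linarith
    positivity
  · have : 0 < β := by linarith
    positivity
  · have := (key (i + n) (by omega)).1
    rwa [show i + n + 1 = i + 1 + n by omega] at this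
  · have := (key (i + n) (by omega)).2
    rwa [show i + n + 1 = i + 1 + n by omega] at this

end Orbit

/-! ### One swing: evaluating the radii, rising, falling, being trapped -/

theorem sSup_radius_eq {P : ℝ → Prop} {t T : ℝ} (htT : t < T) (hP : ∀ s, t < s → s < T → P s)
    (hn : ∀ r, T < r → ∃ s, t < s ∧ s < r ∧ ¬ P s) :
    sSup {x : EReal | ∃ r : ℝ, x = r ∧ (t : EReal) < r ∧
      ∀ s : ℝ, (t : EReal) < s → s < r → P s} = T := by
  refine le_antisymm (sSup_le ?_) (le_sSup ?_)
  · rintro _ ⟨r, rfl, htr, hr⟩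
    by_contra hlt
    obtain ⟨s, h1, h2, h3⟩ := hn r (EReal.coe_lt_coe_iff.1 (not_le.1 hlt))
    exact h3 (hr s (EReal.coe_lt_coe_iff.2 h1) h2)
  · exact ⟨T, rfl, EReal.coe_lt_coe_iff.2 htT, fun s h1 h2 =>
      hP s (EReal.coe_lt_coe_iff.1 h1) h2⟩

theorem sSup_radius_eq_top {P : ℝ → Prop} {t : ℝ} (hP : ∀ s, t < s → P s) :
    sSup {x : EReal | ∃ r : ℝ, x = r ∧ (t : EReal) < r ∧
      ∀ s : ℝ, (t : EReal) < s → s < r → P s} = ⊤ := by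
  rw [EReal.eq_top_iff_forall_lt]
  intro y
  have hlt : y < max (y + 1) (t + 1) := lt_max_of_lt_left (by linarith)
  refine (EReal.coe_lt_coe_iff.2 hlt).trans_le (le_sSup ⟨_, rfl, ?_, ?_⟩)
  · exact EReal.coe_lt_coe_iff.2 (lt_max_of_lt_right (by linarith))
  · exact fun s h1 _ => hP s (EReal.coe_lt_coe_iff.1 h1)

theorem atRadius_coe (g : ℝ → ℝ) (z : ℝ) : atRadius g (z : EReal) = g z := by
  simp [atRadius]

theorem atRadius_top {g : ℝ → ℝ} {l : ℝ} (h : Tendsto g atTop (𝓝 l)) : atRadius g ⊤ = l := by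
  simp only [atRadius, if_true]
  exact h.limUnder_eq

theorem HasDerivAt.nonpos_of_pos_left {g : ℝ → ℝ} {d a x : ℝ} (h : HasDerivAt g d x)
    (hax : a < x) (hx : g x = 0) (hpos : ∀ s ∈ Ioo a x, 0 < g s) : d ≤ 0 := by
  by_contra hd
  obtain ⟨ε, hε, hneg, -⟩ := h.eventually_sign_of_pos (not_le.1 hd) hx
  have hm : max ((a + x) / 2) (x - ε / 2) < x := max_lt (by linarith) (by linarith)
  have h1 := hneg _ ⟨lt_max_of_lt_right (by linarith), hm⟩
  have h2 := hpos _ ⟨lt_max_of_lt_left (by linarith), hm⟩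
  linarith

namespace Orbit

variable {N : ℝ} {f : ℝ → ℝ} {b β α : ℝ} {w : ℝ → ℝ}

theorem strictMonoOn_of_opJ_neg (O : Orbit N f b β α w) {D : Set ℝ} (hD : Convex ℝ D)
    (hD0 : D ⊆ Ici 0) (h : ∀ r ∈ interior D, opJ w r < 0) : StrictMonoOn w D := by
  refine strictMonoOn_of_deriv_pos hD (O.continuousOn.mono hD0) fun x hx => ?_
  have hx0 : 0 < x := by
    have := interior_mono hD0 hx
    rwa [interior_Ici] at this
  rw [deriv_eq_opJ w hx0]
  have := mul_neg_of_pos_of_neg hx0 (h x hx)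
  linarith

theorem strictAntiOn_of_opJ_pos (O : Orbit N f b β α w) {D : Set ℝ} (hD : Convex ℝ D)
    (hD0 : D ⊆ Ici 0) (h : ∀ r ∈ interior D, 0 < opJ w r) : StrictAntiOn w D := by
  refine strictAntiOn_of_deriv_neg hD (O.continuousOn.mono hD0) fun x hx => ?_
  have hx0 : 0 < x := by
    have := interior_mono hD0 hx
    rwa [interior_Ici] at this
  rw [deriv_eq_opJ w hx0]
  have := mul_pos hx0 (h x hx)
  linarith

/-- After an upward zero the orbit rises forever, or until a turning point above `b`. -/
theorem rise (O : Orbit N f b β α w) {R : ℝ} (hR : 0 < R) (hw : w R = 0) (hJ : opJ w R < 0) :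
    (∀ r, R < r → opJ w r < 0 ∧ 0 < w r) ∨
    ∃ T, R < T ∧ opJ w T = 0 ∧ b < w T ∧ (∀ s ∈ Ioo R T, opJ w s < 0) ∧
      ∀ s ∈ Ioc R T, 0 < w s := by
  have hc : ContinuousOn (fun r => -opJ w r) (Ici R) :=
    (O.continuousOn_opJ.mono (Ici_subset_Ici.2 hR.le)).neg
  rcases forall_pos_or_exists_first_zero hc (by linarith) with h | ⟨T, hRT, hT0, h⟩
  · left
    intro r hr
    have hmono := O.strictMonoOn_of_opJ_neg (convex_Ici R) (Ici_subset_Ici.2 hR.le) (by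
      intro s hs
      rw [interior_Ici] at hs
      linarith [h s (le_of_lt hs)])
    have := hmono (mem_Ici.2 le_rfl) (mem_Ici.2 hr.le) hr
    exact ⟨by linarith [h r hr.le], by linarith⟩
  · right
    have hTpos : 0 < T := hR.trans hRT
    have hJT : opJ w T = 0 := by linarith
    have hmono := O.strictMonoOn_of_opJ_neg (convex_Icc R T)
      (fun x hx => mem_Ici.2 (hR.le.trans hx.1)) (by
      intro s hs
      rw [interior_Icc] at hs
      linarith [h s hs.1.le hs.2])
    have hpos : ∀ s ∈ Ioc R T, 0 < w s := by
      intro s hs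
      have := hmono ⟨le_rfl, hRT.le⟩ ⟨hs.1.le, hs.2⟩ hs.1
      linarith
    refine ⟨T, hRT, hJT, ?_, fun s hs => by linarith [h s hs.1.le hs.2], hpos⟩
    have hwT := hpos T ⟨hRT, le_rfl⟩
    -- `𝒥` reaches `0` from below, so `𝒥' ≥ 0` and `f(w) ≥ 0` at the turn; `w = b` being impossible,
    -- the turn is above `b`.
    have hd := (O.hasDerivAt_opJ hTpos).neg.nonpos_of_pos_left hRT (by simpa using hJT)
      (fun s hs => h s hs.1.le hs.2)
    rw [hJT, mul_zero, sub_zero] at hd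
    have hf : 0 ≤ f (w T) := by
      by_contra hneg
      have := div_neg_of_neg_of_pos (not_le.1 hneg) hTpos
      linarith
    have hne := O.abs_ne_b hTpos.le hJT
    rw [abs_of_pos hwT] at hne
    by_contra hle
    exact absurd (O.shape.neg _ hwT (lt_of_le_of_ne (not_lt.1 hle) hne)) hf.not_gt

/-- The alternative `T = 0` covers the start, where `𝒥(0) = f(α)/N` is already positive; at a
genuine turn `𝒥' = f(w)/T > 0`. -/
theorem opJ_pos_right (O : Orbit N f b β α w) {T : ℝ} (hT : 0 ≤ T) (hw : b < w T)
    (hJ : T = 0 ∨ opJ w T = 0) : ∃ ε > 0, ∀ s ∈ Ioo T (T + ε), 0 < opJ w s := by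
  have hf := O.shape.pos _ hw
  rcases hT.eq_or_lt with rfl | hT
  · have h0 : 0 < opJ w 0 := by
      rw [O.opJ_zero, ← O.sol.init]
      exact div_pos hf (by linarith [O.two_lt])
    have hlim : Tendsto (opJ w) (𝓝[>] 0) (𝓝 (opJ w 0)) :=
      (O.continuousOn_opJ 0 (mem_Ici.2 le_rfl)).mono Ioi_subset_Ici_self
    obtain ⟨ε, hε, h⟩ := mem_nhdsGT_iff_exists_Ioo_subset.1 (hlim.eventually (lt_mem_nhds h0))
    exact ⟨ε, hε, fun s hs => h ⟨hs.1, by linarith [hs.2]⟩⟩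
  · have hJ := hJ.resolve_left hT.ne'
    obtain ⟨ε, hε, -, h⟩ := (O.hasDerivAt_opJ hT).eventually_sign_of_pos (by
      rw [hJ, mul_zero, sub_zero]
      exact div_pos hf hT) hJ
    exact ⟨ε, hε, h⟩

/-- After a turning point above `b` the orbit falls forever, or until its height or its slope
vanishes. -/
theorem fall (O : Orbit N f b β α w) {T : ℝ} (hT : 0 ≤ T) (hw : b < w T)
    (hJ : T = 0 ∨ opJ w T = 0) :
    (∀ r, T < r → 0 < opJ w r ∧ 0 < w r) ∨
    ∃ Z, T < Z ∧ min (w Z) (opJ w Z) = 0 ∧ ∀ s ∈ Ioo T Z, 0 < opJ w s ∧ 0 < w s := by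
  obtain ⟨ε, hε, hJε⟩ := O.opJ_pos_right hT hw hJ
  have hlim : Tendsto w (𝓝[>] T) (𝓝 (w T)) :=
    (O.continuousOn T hT).mono fun y hy => mem_Ici.2 (hT.trans (le_of_lt hy))
  obtain ⟨δ, hδ, hwδ⟩ := mem_nhdsGT_iff_exists_Ioo_subset.1
    (hlim.eventually (lt_mem_nhds (O.shape.b_pos.trans hw)))
  have hδ : T < δ := hδ
  set a := min (T + ε / 2) ((T + δ) / 2) with ha
  have haT : T < a := lt_min (by linarith) (by linarith)
  have hbefore : ∀ s, T < s → s ≤ a → 0 < opJ w s ∧ 0 < w s := by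
    intro s h1 h2
    have h3 := h2.trans (min_le_left _ _)
    have h4 := h2.trans (min_le_right _ _)
    exact ⟨hJε s ⟨h1, by linarith⟩, hwδ ⟨h1, by linarith⟩⟩
  -- The first zero of the minimum is the first failure of either sign. The search starts at `a > T`
  -- since `𝒥` may vanish at `T`.
  have hc : ContinuousOn (fun r => min (w r) (opJ w r)) (Ici a) :=
    (continuous_min.comp_continuousOn (O.continuousOn.prodMk O.continuousOn_opJ)).mono
      (Ici_subset_Ici.2 (hT.trans haT.le))
  obtain ⟨h1, h2⟩ := hbefore a haT le_rfl
  rcases forall_pos_or_exists_first_zero hc (lt_min h2 h1) with h | ⟨Z, haZ, hZ, h⟩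
  · left
    intro r hr
    rcases le_total r a with h3 | h3
    · exact hbefore r hr h3
    · exact ⟨(lt_min_iff.1 (h r h3)).2, (lt_min_iff.1 (h r h3)).1⟩
  · right
    refine ⟨Z, haT.trans haZ, hZ, fun s hs => ?_⟩
    rcases le_total s a with h3 | h3
    · exact hbefore s hs.1 h3
    · exact ⟨(lt_min_iff.1 (h s h3 hs.2)).2, (lt_min_iff.1 (h s h3 hs.2)).1⟩

/-- Once the slope vanishes at a positive height during a fall, the orbit is trapped. -/
theorem trapped (O : Orbit N f b β α w) {T Z : ℝ} (hT : 0 ≤ T) (hTZ : T < Z) (hw : 0 < w Z)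
    (hJ : opJ w Z = 0) (hpos : ∀ s ∈ Ioo T Z, 0 < opJ w s) :
    ∃ δ > 0, ∀ r, Z ≤ r → δ ≤ w r := by
  have hZ : 0 < Z := hT.trans_lt hTZ
  have hd := (O.hasDerivAt_opJ hZ).nonpos_of_pos_left hTZ hJ hpos
  rw [hJ, mul_zero, sub_zero] at hd
  have hwb : w Z ≤ b := by
    by_contra hlt
    exact absurd (div_pos (O.shape.pos _ (not_le.1 hlt)) hZ) hd.not_gt
  -- `𝒥' ≤ 0` at `Z` forces `w ≤ b`, hence negative energy. From then on `F(w)` stays below this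
  -- negative value, which bounds `|w|` away from `0`.
  have hE : energy f w Z < 0 := by
    have := O.shape.F_lt_zero hw.ne' (by rw [abs_of_pos hw]; linarith [O.shape.b_lt])
    unfold energy
    rw [hJ]
    simpa using this
  have hcont : Tendsto (primF f) (𝓝 0) (𝓝 0) := by
    have := O.shape.continuous_F.tendsto 0
    rwa [Shape.F_zero] at this
  obtain ⟨δ, hδ, hF⟩ := Metric.eventually_nhds_iff.1 (hcont.eventually (lt_mem_nhds hE))
  have habs : ∀ r, Z ≤ r → δ ≤ |w r| := by
    intro r hr
    by_contra hlt
    have h1 := hF (y := w r) (by rw [Real.dist_eq, sub_zero]; exact not_le.1 hlt)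
    have h2 := (F_le_energy (f := f) (w := w) r).trans
      (O.antitoneOn_energy (mem_Ici.2 hZ.le) (mem_Ici.2 (hZ.le.trans hr)) hr)
    linarith
  refine ⟨δ, hδ, fun r hr => ?_⟩
  rcases forall_pos_or_exists_first_zero
    (O.continuousOn.mono (Ici_subset_Ici.2 hZ.le)) hw with h | ⟨z, hz, hz0, -⟩
  · have := habs r hr
    rwa [abs_of_pos (h r hr)] at this
  · have := habs z hz.le
    rw [hz0, abs_zero] at this
    linarith

end Orbit

/-! ### Induction over the crossings -/

/-- The orbit has just completed its `k`-th crossing of the vertical axis, at the radius `R`. -/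
structure Stage (β : ℝ) (u : ℝ → ℝ → ℝ) (α : ℝ) (k : ℕ) (R : ℝ) : Prop where
  radius : zeroZ (u α) k = R
  nonneg : 0 ≤ R
  mem : α ∈ setN β u k
  count : {r ∈ lineCrossings (u α) | r ≤ R}.encard = k
  of_zero : k = 0 → R = 0
  of_pos : 1 ≤ k → R ∈ lineCrossings (u α) ∧ (-1) ^ k * opJ (u α) R < 0

/-- The way from the `k`-th crossing at `R` to the next one at `Z`, with a turn at `T`. -/
structure Passage (b : ℝ) (w : ℝ → ℝ) (k : ℕ) (R T Z : ℝ) : Prop where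
  le_turn : R ≤ T
  turn_lt : T < Z
  height : b < (-1) ^ k * w T
  turn : 1 ≤ k → R < T ∧ opJ w T = 0
  before : ∀ s ∈ Ioo R T, (-1) ^ k * opJ w s < 0
  after : ∀ s ∈ Ioo T Z, 0 < (-1) ^ k * opJ w s

/-- There is no crossing after `R`, and the orbit stays away from the vertical axis. -/
structure Captured (β : ℝ) (u : ℝ → ℝ → ℝ) (α : ℝ) (k : ℕ) (R : ℝ) : Prop where
  away : ∃ δ > 0, ∃ r₀, ∀ r, r₀ ≤ r → δ ≤ (-1) ^ k * u α r
  mem : α ∈ setP β u (k + 1)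
  pos : ∀ r, R < r → 0 < (-1) ^ k * u α r

/-- There is no crossing after `R`, and the orbit tends to the origin after one turn. -/
structure Decaying (β : ℝ) (u : ℝ → ℝ → ℝ) (α : ℝ) (k : ℕ) (R : ℝ) : Prop where
  tendsto : Tendsto (u α) atTop (𝓝 0)
  mem : α ∈ setG β u (k + 1)
  pos : ∀ r, R < r → u α r ≠ 0 → 0 < (-1) ^ k * u α r
  no_crossing : ∀ r, R < r → u α r = 0 → opJ (u α) r = 0
  axis : axisCount (u α) k R = 1

theorem neg_one_pow_mul_self (k : ℕ) (x : ℝ) : (-1) ^ k * ((-1) ^ k * x) = x := by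
  rw [← mul_assoc, ← mul_pow]
  simp

section

variable {N : ℝ} {f : ℝ → ℝ} {b β α : ℝ} {u : ℝ → ℝ → ℝ} {k : ℕ} {R : ℝ}

theorem stage_zero (hα : β ≤ α) : Stage β u α 0 0 where
  radius := rfl
  nonneg := le_rfl
  mem := hα
  count := by
    have : {r ∈ lineCrossings (u α) | r ≤ 0} = ∅ := by
      ext r
      simp only [lineCrossings, mem_ofPred_eq, mem_empty_iff_false, iff_false]
      rintro ⟨⟨h1, -⟩, h2⟩
      linarith
    simp [this]
  of_zero := fun _ => rfl
  of_pos := fun h => absurd h (by norm_num)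

/-- The turning radius after the `k`-th crossing. -/
theorem Stage.turn (S : Stage β u α k R) (O : Orbit N f b β α (u α)) (hα : 0 < α) :
    (turnT (u α) k = ⊤ ∧ ∀ r, R < r → (-1) ^ k * opJ (u α) r < 0 ∧ 0 < (-1) ^ k * u α r) ∨
    ∃ T, R ≤ T ∧ turnT (u α) k = T ∧ b < (-1) ^ k * u α T ∧ (k = 0 → T = 0) ∧
      (1 ≤ k → R < T ∧ opJ (u α) T = 0) ∧ (∀ s ∈ Ioo R T, (-1) ^ k * opJ (u α) s < 0) ∧
      ∀ s ∈ Ioc R T, 0 < (-1) ^ k * u α s := by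
  rcases Nat.eq_zero_or_pos k with rfl | hk
  · right
    obtain rfl := S.of_zero rfl
    refine ⟨0, le_rfl, rfl, ?_, fun _ => rfl, fun h => absurd h (by norm_num),
      fun s hs => absurd (hs.1.trans hs.2) (lt_irrefl _),
      fun s hs => absurd (hs.1.trans_le hs.2) (lt_irrefl _)⟩
    rw [pow_zero, one_mul, O.sol.init]
    have := O.b_lt_abs
    rwa [abs_of_pos hα] at this
  obtain ⟨⟨hR0, hR1, hR2⟩, hR3⟩ := S.of_pos hk
  have hσ := neg_one_pow_eq_or ℝ k
  have O' := O.const_mul hσ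
  have hJ' := fun r hr => O.opJ_const_mul O' hσ (r := r) hr
  -- The sign index in `turnT` is one ahead: for `k ≥ 1`, `turnT k` uses the exponent `k + 1`.
  have hturn : turnT (u α) k = turnFrom (u α) (k + 1) (R : EReal) := by
    obtain ⟨n, rfl⟩ := Nat.exists_eq_add_of_le' hk
    rw [← S.radius]
    rfl
  have hsgn : ∀ s, 0 < s → ((-1) ^ (k + 1) * deriv (u α) s ≤ 0 ↔
      (-1) ^ k * opJ (u α) s ≤ 0) := by
    intro s hs
    rw [deriv_eq_opJ _ hs]
    have : (-1 : ℝ) ^ (k + 1) * -(s * opJ (u α) s) = s * ((-1) ^ k * opJ (u α) s) := by ring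
    rw [this]
    exact ⟨fun h => nonpos_of_mul_nonpos_right h hs,
      fun h => mul_nonpos_of_nonneg_of_nonpos hs.le h⟩
  have hne : (R : EReal) ≠ ⊤ := EReal.coe_ne_top R
  rcases O'.rise hR0 (by simp [hR1]) (by rw [hJ' R hR0.le]; exact hR3) with
    h | ⟨T, hRT, hT0, hTb, hTJ, hTw⟩
  · left
    have h' : ∀ r, R < r → (-1) ^ k * opJ (u α) r < 0 ∧ 0 < (-1) ^ k * u α r := by
      intro r hr
      obtain ⟨h1, h2⟩ := h r hr
      rw [hJ' r (hR0.trans hr).le] at h1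
      exact ⟨h1, h2⟩
    refine ⟨?_, h'⟩
    rw [hturn, turnFrom, if_neg hne]
    exact sSup_radius_eq_top fun s hs => (hsgn s (hR0.trans hs)).2 (h' s hs).1.le
  · right
    have hTpos := hR0.trans hRT
    refine ⟨T, hRT.le, ?_, hTb, fun h => absurd hk (by omega), fun _ => ⟨hRT, ?_⟩,
      fun s hs => ?_, hTw⟩
    · rw [hturn, turnFrom, if_neg hne]
      refine sSup_radius_eq hRT (fun s h1 h2 => ?_) fun r hr => ?_
      · rw [hsgn s (hR0.trans h1), ← hJ' s (hR0.trans h1).le]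
        exact (hTJ s ⟨h1, h2⟩).le
      · obtain ⟨ε, hε, h⟩ := O'.opJ_pos_right hTpos.le hTb (Or.inr hT0)
        have hm : T < min (T + ε / 2) ((T + r) / 2) := lt_min (by linarith) (by linarith)
        refine ⟨_, hRT.trans hm, (min_le_right _ _).trans_lt (by linarith), ?_⟩
        rw [hsgn _ (hTpos.trans hm), ← hJ' _ (hTpos.trans hm).le, not_le]
        exact h _ ⟨hm, (min_le_left _ _).trans_lt (by linarith)⟩
    · rw [hJ' T hTpos.le] at hT0
      exact (mul_eq_zero.1 hT0).resolve_left (pow_ne_zero _ (by norm_num))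
    · rw [← hJ' s (hR0.trans hs.1).le]
      exact hTJ s hs

/-- The value at `Z = ∞` is a limit, identified as `(-1)^k b` by `tendsto_curveJ`. -/
theorem Stage.mem_setP_of_top (S : Stage β u α k R) (O : Orbit N f b β α (u α))
    (hZ : zeroZ (u α) (k + 1) = ⊤) {δ r₀ : ℝ} (hδ : 0 < δ)
    (h : ∀ r, r₀ ≤ r → δ ≤ (-1) ^ k * u α r) : α ∈ setP β u (k + 1) := by
  refine ⟨S.mem, ?_⟩
  have O' := O.const_mul (neg_one_pow_eq_or ℝ k)
  have h1 : Tendsto (fun r => (-1) ^ k * u α r) atTop (𝓝 b) :=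
    (continuous_fst.tendsto _).comp (O'.tendsto_curveJ hδ h)
  have h2 := h1.const_mul ((-1) ^ k)
  simp only [neg_one_pow_mul_self] at h2
  rw [hZ, atRadius_top h2, pow_succ, mul_assoc, neg_one_mul, mul_neg, neg_one_pow_mul_self]
  linarith [O.shape.b_pos]

/-- The single axis point is the turn `T`; for `k = 0` its role is played by the initial point,
counted by convention. -/
theorem axisCount_eq_one {w : ℝ → ℝ} {T : ℝ} (hRT : R ≤ T) (h0 : k = 0 → T = 0)
    (hR0 : k = 0 → R = 0) (h1 : 1 ≤ k → R < T ∧ opJ w T = 0) (hT : w T ≠ 0)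
    (hbefore : ∀ s ∈ Ioo R T, opJ w s ≠ 0) (hafter : ∀ s, T < s → w s ≠ 0 → opJ w s ≠ 0) :
    axisCount w k R = 1 := by
  unfold axisCount
  rcases Nat.eq_zero_or_pos k with rfl | hk
  · have : {r | R < r ∧ w r ≠ 0 ∧ opJ w r = 0} = ∅ := by
      ext r
      simp only [mem_ofPred_eq, mem_empty_iff_false, iff_false]
      rintro ⟨hr1, hr2, hr3⟩
      rw [hR0 rfl, ← h0 rfl] at hr1
      exact hafter r hr1 hr2 hr3
    rw [this]
    simp
  · have : {r | R < r ∧ w r ≠ 0 ∧ opJ w r = 0} = {T} := by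
      ext r
      simp only [mem_ofPred_eq, mem_singleton_iff]
      constructor
      · rintro ⟨hr1, hr2, hr3⟩
        rcases lt_trichotomy r T with h | h | h
        · exact absurd hr3 (hbefore r ⟨hr1, h⟩)
        · exact h
        · exact absurd hr3 (hafter r h hr2)
      · rintro rfl
        exact ⟨(h1 hk).1, hT, (h1 hk).2⟩
    rw [this, if_neg (by omega)]
    simp

/-- From the `k`-th crossing the orbit is captured, decays, or crosses again. -/
theorem Stage.outcome (S : Stage β u α k R) (O : Orbit N f b β α (u α)) (hα : 0 < α) :
    Captured β u α k R ∨ Decaying β u α k R ∨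
    ∃ T Z, Passage b (u α) k R T Z ∧ Stage β u α (k + 1) Z := by
  have hσ := neg_one_pow_eq_or ℝ k
  have O' := O.const_mul hσ
  have hJ' := fun r hr => O.opJ_const_mul O' hσ (r := r) hr
  have hσ0 : ((-1 : ℝ) ^ k) ≠ 0 := pow_ne_zero _ (by norm_num)
  have hzero : zeroZ (u α) (k + 1) = crossFrom (u α) (k + 1) (turnT (u α) k) := rfl
  rcases S.turn O hα with ⟨htop, hrise⟩ | ⟨T, hRT, hT, hTb, hT0, hT1, hbefore, hwT⟩
  · left
    have hZ : zeroZ (u α) (k + 1) = ⊤ := by rw [hzero, htop, crossFrom, if_pos rfl]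
    have hmono := O'.strictMonoOn_of_opJ_neg (convex_Ici R) (Ici_subset_Ici.2 S.nonneg) (by
      intro r hr
      rw [interior_Ici] at hr
      rw [hJ' r (S.nonneg.trans (le_of_lt hr))]
      exact (hrise r hr).1)
    have hδ := (hrise (R + 1) (by linarith)).2
    have hge : ∀ r, R + 1 ≤ r → (-1) ^ k * u α (R + 1) ≤ (-1) ^ k * u α r := fun r hr =>
      hmono.monotoneOn (mem_Ici.2 (by linarith)) (mem_Ici.2 (by linarith)) hr
    exact ⟨⟨_, hδ, _, hge⟩, S.mem_setP_of_top O hZ hδ hge, fun r hr => (hrise r hr).2⟩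
  have hTnn : 0 ≤ T := S.nonneg.trans hRT
  have hTJ : T = 0 ∨ opJ (fun r => (-1) ^ k * u α r) T = 0 := by
    rcases Nat.eq_zero_or_pos k with h | h
    · exact Or.inl (hT0 h)
    · right
      rw [hJ' T hTnn, (hT1 h).2, mul_zero]
  have huT : u α T ≠ 0 := by
    intro h
    rw [h, mul_zero] at hTb
    linarith [O.shape.b_pos]
  have hne : (T : EReal) ≠ ⊤ := EReal.coe_ne_top T
  have hbefore' : ∀ s ∈ Ioo R T, opJ (u α) s ≠ 0 := by
    intro s hs h
    have := hbefore s hs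
    rw [h, mul_zero] at this
    exact lt_irrefl _ this
  have hsgn : ∀ s, 0 < s → (((-1) ^ (k + 1) * u α s < 0 ∧ 0 < (-1) ^ (k + 1) * deriv (u α) s) ↔
      (0 < (-1) ^ k * opJ (u α) s ∧ 0 < (-1) ^ k * u α s)) := by
    intro s hs
    rw [deriv_eq_opJ _ hs]
    have h1 : (-1 : ℝ) ^ (k + 1) * -(s * opJ (u α) s) = s * ((-1) ^ k * opJ (u α) s) := by ring
    have h2 : (-1 : ℝ) ^ (k + 1) * u α s = -((-1) ^ k * u α s) := by ring
    rw [h1, h2, neg_lt_zero, mul_pos_iff_of_pos_left hs, and_comm]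
  rcases O'.fall hTnn hTb hTJ with h | ⟨Z, hTZ, hZmin, h⟩
  · have hafter : ∀ s, T < s → 0 < (-1) ^ k * opJ (u α) s ∧ 0 < (-1) ^ k * u α s := by
      intro s hs
      rw [← hJ' s (hTnn.trans hs.le)]
      exact h s hs
    have hZ : zeroZ (u α) (k + 1) = ⊤ := by
      rw [hzero, hT, crossFrom, if_neg hne]
      exact sSup_radius_eq_top fun s hs => (hsgn s (hTnn.trans_lt hs)).2 (hafter s hs)
    have hanti := O'.strictAntiOn_of_opJ_pos (convex_Ici T) (Ici_subset_Ici.2 hTnn) (by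
      intro r hr
      rw [interior_Ici] at hr
      exact (h r hr).1)
    have hposall : ∀ r, R < r → 0 < (-1) ^ k * u α r := by
      intro r hr
      rcases le_or_gt r T with h1 | h1
      · exact hwT r ⟨hr, h1⟩
      · exact (h r h1).2
    have hposT : ∀ r, T ≤ r → 0 < (-1) ^ k * u α r := by
      intro r hr
      rcases hr.eq_or_lt with rfl | h1
      · linarith [O.shape.b_pos]
      · exact (h r h1).2
    have hanti' : Antitone fun r => (-1) ^ k * u α (max r T) := fun r s hrs =>
      hanti.antitoneOn (mem_Ici.2 (le_max_right _ _)) (mem_Ici.2 (le_max_right _ _))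
        (max_le_max_right T hrs)
    have hbdd : BddBelow (range fun r => (-1) ^ k * u α (max r T)) := by
      refine ⟨0, ?_⟩
      rintro _ ⟨r, rfl⟩
      exact (hposT _ (le_max_right _ _)).le
    set L := ⨅ r, (-1) ^ k * u α (max r T) with hL
    have hL0 : 0 ≤ L := le_ciInf fun r => (hposT _ (le_max_right _ _)).le
    have hLle : ∀ r, T ≤ r → L ≤ (-1) ^ k * u α r := by
      intro r hr
      have := ciInf_le hbdd r
      rwa [max_eq_left hr] at this
    -- A fall lasting forever has a limit `L ≥ 0`: zero means decay to the origin, positive means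
    -- capture.
    rcases hL0.eq_or_lt with h0 | h0
    · right
      left
      have hlim : Tendsto (u α) atTop (𝓝 0) := by
        have h1 := (tendsto_atTop_ciInf hanti' hbdd).const_mul ((-1) ^ k)
        simp only [neg_one_pow_mul_self] at h1
        rw [← hL, ← h0, mul_zero] at h1
        refine h1.congr' ?_
        filter_upwards [eventually_ge_atTop T] with r hr
        rw [max_eq_left hr]
      have hlim' : Tendsto (deriv (u α)) atTop (𝓝 0) := by
        have h1 := (O.tendsto_slope_zero hlim).neg
        rw [neg_zero] at h1
        refine h1.congr' ?_
        filter_upwards [eventually_gt_atTop 0] with r hr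
        rw [deriv_eq_opJ _ hr]
      refine ⟨hlim, ⟨S.mem, ?_, ?_⟩, fun r hr _ => hposall r hr, fun r hr h1 => ?_, ?_⟩
      · rw [hZ, atRadius_top hlim]
      · rw [hZ, atRadius_top hlim']
      · have := hposall r hr
        rw [h1, mul_zero] at this
        exact absurd this (lt_irrefl _)
      · refine axisCount_eq_one hRT hT0 S.of_zero hT1 huT hbefore' fun s hs _ h1 => ?_
        have := (hafter s hs).1
        rw [h1, mul_zero] at this
        exact lt_irrefl _ this
    · left
      exact ⟨⟨L, h0, T, hLle⟩, S.mem_setP_of_top O hZ h0 hLle, hposall⟩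
  · have hZ0 : 0 < Z := hTnn.trans_lt hTZ
    have hafter : ∀ s ∈ Ioo T Z, 0 < (-1) ^ k * opJ (u α) s ∧ 0 < (-1) ^ k * u α s := by
      intro s hs
      rw [← hJ' s (hTnn.trans hs.1.le)]
      exact h s hs
    have hposall : ∀ r, R < r → r < Z → 0 < (-1) ^ k * u α r := by
      intro r hr hrZ
      rcases le_or_gt r T with h1 | h1
      · exact hwT r ⟨hr, h1⟩
      · exact (h r ⟨h1, hrZ⟩).2
    rw [hJ' Z hZ0.le] at hZmin
    have hZ : zeroZ (u α) (k + 1) = Z := by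
      rw [hzero, hT, crossFrom, if_neg hne]
      refine sSup_radius_eq hTZ
        (fun s h1 h2 => (hsgn s (hTnn.trans_lt h1)).2 (hafter s ⟨h1, h2⟩))
        -- The strict sign conditions already fail at `Z` itself.
        fun r hr => ⟨Z, hTZ, hr, fun hcon => ?_⟩
      obtain ⟨h1, h2⟩ := (hsgn Z hZ0).1 hcon
      exact absurd hZmin (lt_min h2 h1).ne'
    have hwZ : 0 ≤ (-1) ^ k * u α Z := hZmin ▸ min_le_left _ _
    have hJZ : 0 ≤ (-1) ^ k * opJ (u α) Z := hZmin ▸ min_le_right _ _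
    rcases hwZ.eq_or_lt with hw0 | hw0
    · have huZ : u α Z = 0 := (mul_eq_zero.1 hw0.symm).resolve_left hσ0
      rcases hJZ.eq_or_lt with hJ0 | hJ0
      · right
        left
        have hJZ0 : opJ (u α) Z = 0 := (mul_eq_zero.1 hJ0.symm).resolve_left hσ0
        have hz : ∀ r, Z ≤ r → u α r = 0 ∧ opJ (u α) r = 0 := fun r hr =>
          (Orbit.curveJ_eq_zero_iff r).1 (O.curveJ_eq_zero_of_le hZ0.le hr
            ((Orbit.curveJ_eq_zero_iff Z).2 ⟨huZ, hJZ0⟩))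
        refine ⟨?_, ⟨S.mem, ?_, ?_⟩, fun r hr h1 => hposall r hr
          (not_le.1 fun h2 => h1 (hz r h2).1), fun r hr h1 => ?_, ?_⟩
        · refine tendsto_const_nhds.congr' ?_
          filter_upwards [eventually_ge_atTop Z] with r hr using (hz r hr).1.symm
        · rw [hZ, atRadius_coe, huZ]
        · rw [hZ, atRadius_coe, deriv_eq_opJ _ hZ0, hJZ0]
          simp
        · rcases lt_or_ge r Z with h2 | h2
          · have := hposall r hr h2
            rw [h1, mul_zero] at this
            exact absurd this (lt_irrefl _)
          · exact (hz r h2).2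
        · refine axisCount_eq_one hRT hT0 S.of_zero hT1 huT hbefore' fun s hs hus h1 => ?_
          rcases lt_or_ge s Z with h2 | h2
          · have := (hafter s ⟨hs, h2⟩).1
            rw [h1, mul_zero] at this
            exact lt_irrefl _ this
          · exact hus (hz s h2).1
      · right
        right
        have hJZ0 : opJ (u α) Z ≠ 0 := by
          intro h1
          rw [h1, mul_zero] at hJ0
          exact lt_irrefl _ hJ0
        have hZmem : Z ∈ lineCrossings (u α) := ⟨hZ0, huZ, hJZ0⟩
        refine ⟨T, Z, ⟨hRT, hTZ, hTb, hT1, hbefore, fun s hs => (hafter s hs).1⟩,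
          ⟨hZ, hZ0.le, ⟨S.mem, ?_, ?_⟩, ?_, fun h1 => absurd h1 k.succ_ne_zero,
            fun _ => ⟨hZmem, ?_⟩⟩⟩
        · rw [hZ, atRadius_coe, huZ]
        · rw [hZ, atRadius_coe, deriv_eq_opJ _ hZ0]
          have h1 : (-1 : ℝ) ^ (k + 1) * -(Z * opJ (u α) Z) = Z * ((-1) ^ k * opJ (u α) Z) := by
            ring
          rw [h1]
          exact mul_pos hZ0 hJ0
        · have hins : {r ∈ lineCrossings (u α) | r ≤ Z} =
              insert Z {r ∈ lineCrossings (u α) | r ≤ R} := by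
            ext r
            simp only [mem_ofPred_eq, mem_insert_iff]
            constructor
            · rintro ⟨h1, h2⟩
              rcases h2.eq_or_lt with h3 | h3
              · exact Or.inl h3
              · right
                refine ⟨h1, ?_⟩
                by_contra hlt
                have := hposall r (not_le.1 hlt) h3
                rw [h1.2.1, mul_zero] at this
                exact lt_irrefl _ this
            · rintro (rfl | ⟨h1, h2⟩)
              · exact ⟨hZmem, le_rfl⟩
              · exact ⟨h1, h2.trans (hRT.trans hTZ.le)⟩
          rw [hins, encard_insert_of_notMem, S.count]
          · push_cast
            rfl
          · rintro ⟨-, h1⟩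
            linarith
        · rw [pow_succ]
          linarith
    · left
      have hJ0 : (-1) ^ k * opJ (u α) Z = 0 := by
        rcases min_choice ((-1) ^ k * u α Z) ((-1) ^ k * opJ (u α) Z) with h1 | h1
        · rw [hZmin] at h1
          exact absurd h1 hw0.ne
        · rw [← h1, hZmin]
      obtain ⟨δ, hδ, hge⟩ := O'.trapped hTnn hTZ hw0 (by rw [hJ' Z hZ0.le, hJ0])
        fun s hs => (h s hs).1
      refine ⟨⟨δ, hδ, Z, hge⟩, ⟨S.mem, ?_⟩, fun r hr => ?_⟩
      · rw [hZ, atRadius_coe, pow_succ]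
        linarith
      · rcases lt_or_ge r Z with h2 | h2
        · exact hposall r hr h2
        · exact hδ.trans_le (hge r h2)

end

/-! ### The last crossing and the rotation about each centre -/

section

variable {N : ℝ} {f : ℝ → ℝ} {b β α : ℝ} {u : ℝ → ℝ → ℝ} {k : ℕ} {R : ℝ}

theorem Orbit.energy_pos_of_crossing {w : ℝ → ℝ} {r : ℝ} (h : r ∈ lineCrossings w) :
    0 < energy f w r := by
  obtain ⟨h0, h1, h2⟩ := h
  unfold energy
  rw [h1, Shape.F_zero]
  have := mul_ne_zero h0.ne' h2
  positivity

/-- Up to the last crossing, the orbit meets the horizontal axis only outside `(-β, β)`. -/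
theorem Stage.le_abs (S : Stage β u α k R) (O : Orbit N f b β α (u α)) {r : ℝ}
    (hr : r ∈ Icc 0 R) (hJ : opJ (u α) r = 0) : β ≤ |u α r| := by
  rcases Nat.eq_zero_or_pos k with hk | hk
  · have hr0 : r = 0 := le_antisymm ((S.of_zero hk) ▸ hr.2) hr.1
    rw [hr0] at hJ
    exact absurd hJ O.opJ_zero_ne
  · have hE := (Orbit.energy_pos_of_crossing (f := f) (S.of_pos hk).1).trans_le
      (O.antitoneOn_energy (mem_Ici.2 hr.1) (mem_Ici.2 S.nonneg) hr.2)
    refine O.le_abs_of_energy_nonneg hE.le hJ fun h => ?_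
    exact Orbit.curveJ_ne_zero_of_energy_pos hE ((Orbit.curveJ_eq_zero_iff r).2 ⟨h, hJ⟩)

/-- The orbit crosses the vertical axis finitely often. -/
theorem exists_last_stage (O : Orbit N f b β α (u α)) (hα : β ≤ α) :
    ∃ k R, Stage β u α k R ∧ (Captured β u α k R ∨ Decaying β u α k R) := by
  have hβ : 0 < β := O.shape.b_pos.trans O.shape.b_lt
  by_contra hcon
  push Not at hcon
  have hnext : ∀ k R, Stage β u α k R →
      ∃ T Z, Passage b (u α) k R T Z ∧ Stage β u α (k + 1) Z := fun k R S =>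
    ((S.outcome O (hβ.trans_le hα)).resolve_left (hcon k R S).1).resolve_left (hcon k R S).2
  have hall : ∀ k, ∃ R, Stage β u α k R := by
    intro k
    induction k with
    | zero => exact ⟨0, stage_zero hα⟩
    | succ k ih =>
      obtain ⟨R, hR⟩ := ih
      obtain ⟨T, Z, -, hZ⟩ := hnext k R hR
      exact ⟨Z, hZ⟩
  choose R hR using hall
  -- The end of each passage is the chosen `R (k + 1)`, because both equal `zeroZ (k + 1)`.
  have hpass : ∀ k, ∃ T, Passage b (u α) k (R k) T (R (k + 1)) := by
    intro k
    obtain ⟨T, Z, hP, hZ⟩ := hnext k (R k) (hR k)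
    have h1 := hZ.radius.symm.trans (hR (k + 1)).radius
    rw [EReal.coe_eq_coe_iff] at h1
    exact ⟨T, h1 ▸ hP⟩
  choose T hP using hpass
  have hE : ∀ k, 0 < energy f (u α) (T k) := by
    intro k
    refine (Orbit.energy_pos_of_crossing (f := f) ((hR (k + 1)).of_pos (by omega)).1).trans_le
      (O.antitoneOn_energy ?_ ?_ (hP k).turn_lt.le)
    · exact mem_Ici.2 ((hR k).nonneg.trans (hP k).le_turn)
    · exact mem_Ici.2 (hR (k + 1)).nonneg
  have hpow : ∀ i : ℕ, (-1 : ℝ) ^ (i + 2) = (-1) ^ i := fun i => by rw [pow_add]; norm_num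
  -- The turn of index `0` is the initial point, which is not a zero of `𝒥`. A shift by two skips it
  -- and preserves parity.
  refine O.not_forall_turning (T := fun i => T (i + 2))
    (fun i => (hR (i + 2)).nonneg.trans_lt ((hP (i + 2)).turn (by omega)).1)
    (fun i => (hP (i + 2)).turn_lt.trans_le (hP (i + 2 + 1)).le_turn)
    (fun i => ((hP (i + 2)).turn (by omega)).2) (fun i => ?_) (fun i s hs => ?_)
    (fun i => hE (i + 2))
  · have h1 := (hP (i + 2)).height
    rw [hpow] at h1
    have h2 : 0 < (-1) ^ i * u α (T (i + 2)) := O.shape.b_pos.trans h1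
    have h3 := O.le_abs_of_energy_nonneg (hE (i + 2)).le ((hP (i + 2)).turn (by omega)).2
      (fun h => by
        rw [h, mul_zero] at h2
        exact lt_irrefl _ h2)
    rw [← abs_of_pos h2, abs_mul]
    simpa using h3
  · rcases lt_trichotomy s (R (i + 2 + 1)) with h | h | h
    · have := (hP (i + 2)).after s ⟨hs.1, h⟩
      rw [hpow] at this
      rw [pow_succ]
      linarith
    · have := ((hR (i + 2 + 1)).of_pos (by omega)).2
      rw [← h, show i + 2 + 1 = i + 1 + 2 by omega, hpow] at this
      exact this
    · have h1 := (hP (i + 2 + 1)).before s ⟨h, by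
        have := hs.2
        rwa [show i + 1 + 2 = i + 2 + 1 by omega] at this⟩
      rw [show i + 2 + 1 = i + 1 + 2 by omega, hpow] at h1
      exact h1

/-- A zero with nonzero slope changes sign; after a double zero `w` vanishes identically, so no sign
change occurs there. -/
theorem signChanges_eq_lineCrossings {w : ℝ → ℝ} (O : Orbit N f b β α w) :
    signChanges w = lineCrossings w := by
  ext r
  constructor
  · rintro ⟨hr, ε, hε, h⟩
    have hc : ContinuousAt w r := (O.hasDerivAt hr).continuousAt
    have hw : w r = 0 := by
      have hl : Tendsto (fun x => w (r - x) * w (r + x)) (𝓝[>] 0) (𝓝 (w r * w r)) := by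
        have h1 : Tendsto (fun x : ℝ => r - x) (𝓝[>] 0) (𝓝 r) := by
          have : Tendsto (fun x : ℝ => r - x) (𝓝 0) (𝓝 (r - 0)) :=
            (continuous_const.sub continuous_id).tendsto 0
          rw [sub_zero] at this
          exact this.mono_left nhdsWithin_le_nhds
        have h2 : Tendsto (fun x : ℝ => r + x) (𝓝[>] 0) (𝓝 r) := by
          have : Tendsto (fun x : ℝ => r + x) (𝓝 0) (𝓝 (r + 0)) :=
            (continuous_const.add continuous_id).tendsto 0
          rw [add_zero] at this
          exact this.mono_left nhdsWithin_le_nhds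
        exact (hc.tendsto.comp h1).mul (hc.tendsto.comp h2)
      have : w r * w r ≤ 0 := by
        refine le_of_tendsto hl ?_
        filter_upwards [Ioo_mem_nhdsGT hε] with x hx
        exact (h (r - x) ⟨by linarith [hx.2], by linarith [hx.1]⟩ (r + x)
          ⟨by linarith [hx.1], by linarith [hx.2]⟩).le
      exact mul_self_eq_zero.1 (le_antisymm this (mul_self_nonneg _))
    refine ⟨hr, hw, fun hJ => ?_⟩
    have h1 := O.curveJ_eq_zero_of_le hr.le (show r ≤ r + ε / 2 by linarith)
      ((Orbit.curveJ_eq_zero_iff r).2 ⟨hw, hJ⟩)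
    have h2 := h (r - ε / 2) ⟨by linarith, by linarith⟩ (r + ε / 2) ⟨by linarith, by linarith⟩
    rw [((Orbit.curveJ_eq_zero_iff _).1 h1).1, mul_zero] at h2
    exact lt_irrefl _ h2
  · rintro ⟨hr, hw, hJ⟩
    refine ⟨hr, ?_⟩
    have hd := O.hasDerivAt hr
    have hd0 : -(r * opJ w r) ≠ 0 := neg_ne_zero.2 (mul_ne_zero hr.ne' hJ)
    rcases lt_or_gt_of_ne hd0 with h | h
    · obtain ⟨ε, hε, h1, h2⟩ := hd.neg.eventually_sign_of_pos (neg_pos.2 h) (by simp [hw])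
      refine ⟨ε, hε, fun s hs t ht => mul_neg_of_pos_of_neg ?_ ?_⟩
      · simpa using h1 s hs
      · simpa using h2 t ht
    · obtain ⟨ε, hε, h1, h2⟩ := hd.eventually_sign_of_pos h hw
      exact ⟨ε, hε, fun s hs t ht => mul_neg_of_neg_of_pos (h1 s hs) (h2 t ht)⟩

/-- Up to `R` all axis points lie beyond `β`, where `s f(s) > 0` and `F` increases with `|s|`;
strict energy loss then brings them closer. -/
theorem Stage.spiralsInAbout_zero (S : Stage β u α k R) (O : Orbit N f b β α (u α)) :
    SpiralsInAbout (curveJ (u α)) 0 (Icc 0 R) := by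
  have hb := O.shape.b_lt
  refine O.spiralsInAbout (convex_Icc 0 R) ⟨0, le_rfl, S.nonneg⟩ (fun r hr => hr.1) ?_ ?_ ?_
  · rw [O.sol.init]
    intro h
    have := O.b_lt_abs
    rw [h, abs_zero] at this
    linarith [O.shape.b_pos]
  · intro r hr hJ
    rw [sub_zero]
    exact O.shape.mul_f_pos (hb.trans_le (S.le_abs O hr hJ))
  · intro r₁ h1 r₂ h2 h12 hJ1 hJ2 _
    rw [sub_zero, sub_zero]
    have hb1 := hb.trans_le (S.le_abs O h1 hJ1)
    have hE := O.energy_strict h1.1 h12 (by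
      rw [Ne, Orbit.curveJ_eq_zero_iff]
      rintro ⟨h, -⟩
      rw [h, abs_zero] at hb1
      linarith [O.shape.b_pos])
    by_contra hle
    have h3 := O.shape.F_strictMonoOn.monotoneOn (mem_Ici.2 hb1.le)
      (mem_Ici.2 (hb1.le.trans (not_lt.1 hle))) (not_lt.1 hle)
    rw [O.shape.F_abs, O.shape.F_abs] at h3
    unfold energy at hE
    rw [hJ1, hJ2] at hE
    simp only [mul_zero] at hE
    linarith

/-- The orbit stays on one side of the vertical axis after `R`. -/
theorem Stage.pos_of_opJ_eq_zero (S : Stage β u α k R) (O : Orbit N f b β α (u α))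
    (hpos : ∀ r, R < r → u α r ≠ 0 → 0 < (-1) ^ k * u α r) {r : ℝ} (hr : R ≤ r)
    (hne : curveJ (u α) r ≠ 0) (hJ : opJ (u α) r = 0) : 0 < (-1) ^ k * u α r := by
  rcases hr.eq_or_lt with rfl | hr
  · exfalso
    rcases Nat.eq_zero_or_pos k with hk | hk
    · rw [S.of_zero hk] at hJ
      exact O.opJ_zero_ne hJ
    · exact (S.of_pos hk).1.2.2 hJ
  · exact hpos r hr fun h => hne ((Orbit.curveJ_eq_zero_iff r).2 ⟨h, hJ⟩)

theorem Stage.sub_mul_f_pos (S : Stage β u α k R) (O : Orbit N f b β α (u α))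
    (hpos : ∀ r, R < r → u α r ≠ 0 → 0 < (-1) ^ k * u α r) {r : ℝ} (hr : R ≤ r)
    (hne : curveJ (u α) r ≠ 0) (hJ : opJ (u α) r = 0) :
    0 < (u α r - (-1) ^ k * b) * f (u α r) := by
  have h0 := S.pos_of_opJ_eq_zero O hpos hr hne hJ
  have h1 := O.abs_ne_b (S.nonneg.trans hr) hJ
  have h2 : |u α r| = (-1) ^ k * u α r := by
    rw [← abs_of_pos h0, abs_mul]
    simp
  rw [h2] at h1
  have h3 := O.shape.sub_mul_f_pos h0 h1
  rcases neg_one_pow_eq_or ℝ k with h | h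
  · rw [h] at h3 ⊢
    simpa using h3
  · rw [h] at h3 ⊢
    rw [neg_one_mul, O.shape.odd] at h3
    linarith

theorem Orbit.init_ne_center (O : Orbit N f b β α (u α)) (k : ℕ) : u α 0 ≠ (-1) ^ k * b := by
  rw [O.sol.init]
  intro h
  have := O.b_lt_abs
  rw [h, abs_mul, abs_of_pos O.shape.b_pos] at this
  simp at this

theorem Stage.curveJ_ne_zero (S : Stage β u α k R) (O : Orbit N f b β α (u α)) :
    curveJ (u α) R ≠ 0 := by
  rcases Nat.eq_zero_or_pos k with hk | hk
  · rw [S.of_zero hk]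
    exact O.curveJ_zero_ne
  · exact fun h => (S.of_pos hk).1.2.2 ((Orbit.curveJ_eq_zero_iff R).1 h).2

theorem Stage.spiralsInAbout_center (S : Stage β u α k R) (O : Orbit N f b β α (u α))
    (hpos : ∀ r, R < r → u α r ≠ 0 → 0 < (-1) ^ k * u α r) :
    SpiralsInAbout (curveJ (u α)) ((-1) ^ k * b) {r | R ≤ r ∧ curveJ (u α) r ≠ 0} := by
  have hconv : Convex ℝ {r | R ≤ r ∧ curveJ (u α) r ≠ 0} := by
    refine OrdConnected.convex ⟨fun x hx y hy z hz => ⟨hx.1.trans hz.1, fun h => hy.2 ?_⟩⟩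
    exact O.curveJ_eq_zero_of_le (S.nonneg.trans (hx.1.trans hz.1)) hz.2 h
  refine O.spiralsInAbout hconv ⟨R, le_rfl, S.curveJ_ne_zero O⟩
    (fun r hr => S.nonneg.trans hr.1) (O.init_ne_center k)
    (fun r hr hJ => S.sub_mul_f_pos O hpos hr.1 hr.2 hJ) ?_
  intro r₁ h1 r₂ h2 h12 hJ1 hJ2 hside
  have hp1 := S.pos_of_opJ_eq_zero O hpos h1.1 h1.2 hJ1
  have hp2 := S.pos_of_opJ_eq_zero O hpos h2.1 h2.2 hJ2
  have hE := O.energy_strict (S.nonneg.trans h1.1) h12 h1.2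
  unfold energy at hE
  rw [hJ1, hJ2] at hE
  simp only [mul_zero] at hE
  -- On each side of `b`, a smaller `F` means a smaller distance to `b`.
  have key : ∀ y₁ y₂, 0 < y₁ → 0 < y₂ → primF f y₂ < primF f y₁ → 0 < (y₁ - b) * (y₂ - b) →
      |y₂ - b| < |y₁ - b| := by
    intro y₁ y₂ hy1 hy2 hF hs
    rcases pos_and_pos_or_neg_and_neg_of_mul_pos hs with ⟨h3, h4⟩ | ⟨h3, h4⟩
    · rw [abs_of_pos h3, abs_of_pos h4]
      have := (O.shape.F_strictMonoOn.lt_iff_lt (mem_Ici.2 (by linarith))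
        (mem_Ici.2 (by linarith))).1 hF
      linarith
    · rw [abs_of_neg h3, abs_of_neg h4]
      have := (O.shape.F_strictAntiOn.lt_iff_gt ⟨hy2.le, by linarith⟩ ⟨hy1.le, by linarith⟩).1 hF
      linarith
  rcases neg_one_pow_eq_or ℝ k with h | h
  · rw [h] at hp1 hp2 hside ⊢
    rw [one_mul] at *
    exact key _ _ hp1 hp2 (by linarith) hside
  · rw [h] at hp1 hp2 hside ⊢
    have h3 := key _ _ hp1 hp2 (by
      rw [neg_one_mul, neg_one_mul, O.shape.F_neg, O.shape.F_neg]
      linarith) (by linarith)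
    rw [← abs_neg (-1 * u α r₂ - b), ← abs_neg (-1 * u α r₁ - b)] at h3
    convert h3 using 2 <;> ring

theorem Captured.tendsto_curveJ (C : Captured β u α k R) (O : Orbit N f b β α (u α)) :
    Tendsto (curveJ (u α)) atTop (𝓝 ((-1) ^ k * b, 0)) := by
  have hσ := neg_one_pow_eq_or ℝ k
  have O' := O.const_mul hσ
  obtain ⟨δ, hδ, r₀, h⟩ := C.away
  have h1 := O'.tendsto_curveJ hδ h
  have h2 := ((continuous_fst.tendsto _).comp h1).const_mul ((-1) ^ k)
  have h3 := ((continuous_snd.tendsto _).comp h1).const_mul ((-1) ^ k)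
  simp only [mul_zero] at h3
  refine (h2.prodMk_nhds h3).congr' ?_
  filter_upwards [eventually_ge_atTop 0] with r hr
  simp only [Function.comp, curveJ, neg_one_pow_mul_self]
  rw [O.opJ_const_mul O' hσ hr, neg_one_pow_mul_self]

theorem Captured.windsForeverAbout (C : Captured β u α k R) (S : Stage β u α k R)
    (O : Orbit N f b β α (u α)) (h : axisCount (u α) k R = ⊤) :
    WindsForeverAbout (curveJ (u α)) ((-1) ^ k * b) R := by
  have hne : ∀ r, R ≤ r → curveJ (u α) r ≠ 0 := by
    intro r hr
    rcases hr.eq_or_lt with rfl | hr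
    · exact S.curveJ_ne_zero O
    · intro h0
      have := C.pos r hr
      rw [((Orbit.curveJ_eq_zero_iff r).1 h0).1, mul_zero] at this
      exact lt_irrefl _ this
  refine O.windsForeverAbout S.nonneg (O.init_ne_center k) (fun r hr hJ =>
    S.sub_mul_f_pos O (fun r hr _ => C.pos r hr) hr (hne r hr) hJ) ?_
  have hinf : {r | R < r ∧ u α r ≠ 0 ∧ opJ (u α) r = 0}.Infinite := by
    rw [← encard_eq_top_iff]
    by_contra hfin
    rcases ENat.add_eq_top.1 h with h1 | h1
    · split_ifs at h1
      · exact ENat.one_ne_top h1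
      · exact ENat.zero_ne_top h1
    · exact hfin h1
  exact hinf.mono fun r hr => ⟨hr.1, hr.2.2⟩

theorem Decaying.isBoundState (D : Decaying β u α k R) (O : Orbit N f b β α (u α))
    (hcount : (lineCrossings (u α)).encard = k) : IsBoundState N f (u α) k := by
  refine ⟨?_, ?_, D.tendsto, ?_⟩
  · rw [O.sol.init]
    exact O.sol
  · by_contra hcon
    push Not at hcon
    have h1 : Tendsto (u α) atTop (𝓝 (u α 0)) := by
      refine tendsto_const_nhds.congr' ?_
      filter_upwards [eventually_gt_atTop 0] with r hr using (hcon r hr).symm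
    have h2 := tendsto_nhds_unique h1 D.tendsto
    rw [O.sol.init] at h2
    have := O.b_lt_abs
    rw [h2, abs_zero] at this
    linarith [O.shape.b_pos]
  · rw [signChanges_eq_lineCrossings O, hcount]

end

/-! ### Assembly -/

theorem mainTheorem4 (N : ℝ) (hN : 2 < N) (f : ℝ → ℝ) (b β : ℝ) (hf : HypH1 f b β)
    (hb : ∀ s ∈ Ioo 0 b, f s ≠ 0)
    (u : ℝ → ℝ → ℝ) (α : ℝ) (hα : β ≤ α) (hu : IsRadialSolution N f α (u α)) :
    -- start, no self-intersections, inwards on every vertical line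
    ContinuousOn (curveJ (u α)) (Ici 0) ∧
    curveJ (u α) 0 = (α, f α / N) ∧
    InjOn (curveJ (u α)) {r | 0 ≤ r ∧ curveJ (u α) r ≠ 0} ∧
    (∀ r₁ r₂ : ℝ, 0 ≤ r₁ → r₁ < r₂ → curveJ (u α) r₁ ≠ 0 → u α r₁ = u α r₂ →
      |opJ (u α) r₂| < |opJ (u α) r₁|) ∧
    -- `R` is the radius of the `k`-th and last crossing of `s = 0` (`R = 0` if `k = 0`)
    ∃ (k : ℕ) (R : ℝ), 0 ≤ R ∧ (R : EReal) = zeroZ (u α) k ∧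
      (lineCrossings (u α)).encard = k ∧
      (∀ r ∈ lineCrossings (u α), r ≤ R) ∧
      (1 ≤ k → R ∈ lineCrossings (u α)) ∧
      α ∈ setN β u k ∧ α ∉ setN β u (k + 1) ∧
      -- rotation about the origin
      SpiralsInAbout (curveJ (u α)) 0 (Icc 0 R) ∧
      (∀ r ∈ Icc 0 R, opJ (u α) r = 0 → u α r ∉ Ioo (-β) β) ∧
      -- rotation about `(-1)^k b`
      SpiralsInAbout (curveJ (u α)) ((-1) ^ k * b) {r | R ≤ r ∧ curveJ (u α) r ≠ 0} ∧
      (axisCount (u α) k R = 0 →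
        Tendsto (curveJ (u α)) atTop (𝓝 ((-1) ^ k * b, 0)) ∧ α ∈ setP β u (k + 1)) ∧
      (axisCount (u α) k R = 1 →
        (Tendsto (curveJ (u α)) atTop (𝓝 ((-1) ^ k * b, 0)) ∧ α ∈ setP β u (k + 1)) ∨
        (Tendsto (curveJ (u α)) atTop (𝓝 (0, 0)) ∧ α ∈ setG β u (k + 1) ∧
          IsBoundState N f (u α) k)) ∧
      (2 ≤ axisCount (u α) k R →
        Tendsto (curveJ (u α)) atTop (𝓝 ((-1) ^ k * b, 0)) ∧ α ∈ setP β u (k + 1) ∧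
        (axisCount (u α) k R = ⊤ →
          WindsForeverAbout (curveJ (u α)) ((-1) ^ k * b) R)) := by
  have S := hf.shape hb
  have hβ : 0 < β := S.b_pos.trans S.b_lt
  have O : Orbit N f b β α (u α) := ⟨hN, S, hu, by rwa [abs_of_pos (hβ.trans_le hα)]⟩
  refine ⟨O.continuousOn_curveJ, ?_, O.injOn_curveJ, fun r₁ r₂ h1 h12 hne heq =>
    O.abs_opJ_lt h1 h12 hne heq, ?_⟩
  · rw [curveJ, O.sol.init, O.opJ_zero]
  obtain ⟨k, R, hS, hend⟩ := exists_last_stage O hα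
  have hpos : ∀ r, R < r → u α r ≠ 0 → 0 < (-1) ^ k * u α r := by
    rcases hend with C | D
    · exact fun r hr _ => C.pos r hr
    · exact D.pos
  have hlast : ∀ r ∈ lineCrossings (u α), r ≤ R := by
    rintro r ⟨h0, h1, h2⟩
    by_contra hlt
    rcases hend with C | D
    · have := C.pos r (not_le.1 hlt)
      rw [h1, mul_zero] at this
      exact lt_irrefl _ this
    · exact h2 (D.no_crossing r (not_le.1 hlt) h1)
  have hcount : (lineCrossings (u α)).encard = k := by
    rw [← hS.count]
    congr 1
    ext r
    exact ⟨fun h => ⟨h, hlast r h⟩, fun h => h.1⟩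
  refine ⟨k, R, hS.nonneg, hS.radius.symm, hcount, hlast, fun h => (hS.of_pos h).1, hS.mem, ?_,
    hS.spiralsInAbout_zero O, ?_, hS.spiralsInAbout_center O hpos, ?_⟩
  · rintro ⟨-, h1, h2⟩
    rcases hend with C | D
    · have h3 := C.mem.2
      rw [h1, mul_zero] at h3
      exact lt_irrefl _ h3
    · rw [D.mem.2.2, mul_zero] at h2
      exact lt_irrefl _ h2
  · intro r hr hJ hmem
    exact absurd (hS.le_abs O hr hJ) (not_le.2 (abs_lt.2 hmem))
  rcases hend with C | D
  · have hC := And.intro (C.tendsto_curveJ O) C.mem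
    exact ⟨fun _ => hC, fun _ => Or.inl hC, fun _ => ⟨hC.1, hC.2, C.windsForeverAbout hS O⟩⟩
  -- A decaying orbit has exactly one axis point, which excludes `j = 0` and `j ≥ 2`.
  · refine ⟨fun h => ?_, fun _ => Or.inr
      ⟨O.tendsto_curveJ_of_tendsto D.tendsto, D.mem, D.isBoundState O hcount⟩, fun h => ?_⟩
    · rw [D.axis] at h
      exact absurd h one_ne_zero
    · rw [D.axis] at h
      exact absurd h (by norm_num)
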